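/- Consider an uplink with $K$ users, $N$ resource blocks (RBs), $N_r$ receive antennas and $N_t$ transmit antennas per user. Let $H_k^{(n)}\in\mathbb C^{N_r\times N_t}$ be the channel matrix of user $k$ on RB $n$ and $P_k\ge 0$ the power budget of user $k$. Let $\mathcal C\subseteq\{0,1\}^N$ be a set of RB assignments, $\mathcal W\subset\mathbb C^{N_t\times N_t}$ a finite codebook of precoders, and $\mathcal E=\{1,\dots,K\}\times\mathcal C\times\mathcal W$. For $e=(u,c,W)\in\mathcal E$ put $c_e=c$, $W_e=W$, $H_e^{(n)}=H_u^{(n)}$ and $p_e=P_u/\sum_{i=1}^N c(i)$ (if $c=0$, put $p_e=0$), and let $\mathcal S_e\subset\mathbb C$ be a finite constellation of cardinality $S_e$ and unit average energy, $\frac1{S_e}\sum_{z\in\mathcal S_e}|z|^2=1$. For $A\subseteq\mathcal E$ and $1\le n\le N$ let $I^{(n)}(A)$ be the mutual information between the inputs $(x_e)_{e\in A}$ and the output $$y=\sum_{e\in A}\sqrt{p_e}\,c_e(n)H_e^{(n)}W_e x_e+v,$$ where the entries of $x_e$ are independent and uniform on $\mathcal S_e$, the vectors $x_e$, $e\in A$,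 are mutually independent, and $v\sim\mathcal{CN}(0,I)$ is independent of the inputs. (Mutual information and $\log$ are taken to the same base.) Then for all $A\subseteq\mathcal E$ and $1\le n\le N$, $$I^{(n)}(A)\le g^{(n)}(A):=\min_{R\subseteq A}\Big\{\log\det\Big(I+\sum_{e\in A\setminus R}p_e c_e(n)H_e^{(n)}W_e(H_e^{(n)}W_e)^\dagger\Big)+\sum_{e\in R}N_t\log S_e\Big\}.$$ Moreover, the function $g(A)=\sum_{n=1}^N g^{(n)}(A)$ on the subsets of $\mathcal E$ is a rank function: it takes values in $[0,\infty)$, $g(\emptyset)=0$, $g(A)\le g(B)$ whenever $A\subseteq B$, and $g(A\cup\{e\})-g(A)\ge g(B\cup\{e\})-g(B)$ for all $A\subseteq B\subseteq\mathcal E$ and $e\in\mathcal E$. -/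

import Mathlib

open MeasureTheory ProbabilityTheory Matrix
open scoped ENNReal

noncomputable section

namespace Uplink

/-- Data of a single-cell uplink with `K` users, `N` resource blocks (RBs), `Nr` receive antennas
and `Nt` transmit antennas per user. The ground set consists of all triples
(user, RB assignment, precoder). -/
structure System (K N Nr Nt : ℕ) where
  /-- the channel matrix of user `k` on RB `n` -/
  channel : Fin K → Fin N → Matrix (Fin Nr) (Fin Nt) ℂ
  /-- the power budget of user `k` -/
  budget : Fin K → ℝ
  /-- the valid RB assignments, as binary vectors -/
  assignments : Finset (Fin N → Fin 2)
  /-- the codebook of precoders -/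
  codebook : Finset (Matrix (Fin Nt) (Fin Nt) ℂ)
  /-- the constellation used by each element of the ground set -/
  constellation : Fin K × {c // c ∈ assignments} × {W // W ∈ codebook} → Finset ℂ

variable {K N Nr Nt : ℕ}

/-- The ground set of elements `e = (u, c, W)`. -/
abbrev System.Element (s : System K N Nr Nt) : Type :=
  Fin K × {c // c ∈ s.assignments} × {W // W ∈ s.codebook}

/-- `c_e(n)`, a number equal to `0` or `1`. -/
def System.alloc (s : System K N Nr Nt) (e : s.Element) (n : Fin N) : ℝ :=
  ((e.2.1.1 n : ℕ) : ℝ)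

/-- The power level `p_e`: the budget of the user divided by the number of RBs in `c_e`.
(For the zero assignment the value is irrelevant, since then `c_e(n) = 0` for all `n`.) -/
def System.psd (s : System K N Nr Nt) (e : s.Element) : ℝ :=
  s.budget e.1 / ∑ n, s.alloc e n

/-- The effective channel `H_e^{(n)} W_e`. -/
def System.effChannel (s : System K N Nr Nt) (n : Fin N) (e : s.Element) :
    Matrix (Fin Nr) (Fin Nt) ℂ :=
  s.channel e.1 n * e.2.2.1

/-- The constellation of every element has unit average energy. -/
def System.UnitEnergy (s : System K N Nr Nt) : Prop :=
  ∀ e : s.Element, (∑ z ∈ s.constellation e, ‖z‖ ^ 2) / ((s.constellation e).card : ℝ) = 1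

/-- The mutual information `I(X; Y)` in nats of two random variables on a probability space. -/
def mutualInfo {Ω 𝓧 𝓨 : Type*} [MeasurableSpace Ω] [MeasurableSpace 𝓧] [MeasurableSpace 𝓨]
    (μ : Measure Ω) (X : Ω → 𝓧) (Y : Ω → 𝓨) : ℝ≥0∞ :=
  InformationTheory.klDiv (μ.map fun ω => (X ω, Y ω)) ((μ.map X).prod (μ.map Y))

/-- The law `CN(0, 1)`: independent real and imaginary parts, both `N(0, 1/2)`. -/
def complexGaussian : Measure ℂ :=
  ((gaussianReal 0 (1 / 2)).prod (gaussianReal 0 (1 / 2))).map fun z => (⟨z.1, z.2⟩ : ℂ)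

/-- The law `CN(0, I)` of the noise vector. -/
def noiseLaw (Nr : ℕ) : Measure (Fin Nr → ℂ) :=
  Measure.pi fun _ => complexGaussian

/-- The joint law of the inputs `x_e`, `e ∈ A`: these are independent, and the entries of `x_e`
are independent and uniform on the constellation of `e`. -/
def System.inputLaw (s : System K N Nr Nt) (A : Finset s.Element) :
    Measure ((e : A) → Fin Nt → ℂ) :=
  Measure.pi fun e => Measure.pi fun _ => uniformOn (s.constellation e.1 : Set ℂ)

/-- The channel output `y = ∑_{e ∈ A} √p_e c_e(n) H_e^{(n)} W_e x_e + v`. -/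
def System.output (s : System K N Nr Nt) (n : Fin N) (A : Finset s.Element)
    (x : (e : A) → Fin Nt → ℂ) (v : Fin Nr → ℂ) : Fin Nr → ℂ :=
  ∑ e : A, ((Real.sqrt (s.psd e.1) * s.alloc e.1 n : ℝ) : ℂ) • (s.effChannel n e.1 *ᵥ x e) + v

/-- `I^{(n)}(A)`: the mutual information between the inputs `(x_e)_{e ∈ A}` and the output on RB
`n`, the noise being independent of the inputs. -/
def System.info (s : System K N Nr Nt) (n : Fin N) (A : Finset s.Element) : ℝ≥0∞ :=
  mutualInfo ((s.inputLaw A).prod (noiseLaw Nr)) (fun ω => ω.1) (fun ω => s.output n A ω.1 ω.2)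

/-- `log det (I + ∑_{e ∈ A} p_e c_e(n) H_e W_e (H_e W_e)†)`, the determinant being a positive
real number. -/
def System.logDet (s : System K N Nr Nt) (n : Fin N) (A : Finset s.Element) : ℝ :=
  Real.log (1 + ∑ e ∈ A, ((s.psd e * s.alloc e n : ℝ) : ℂ) •
    (s.effChannel n e * (s.effChannel n e)ᴴ)).det.re

open Classical in
/-- `g^{(n)}(A)`. -/
def System.gRB (s : System K N Nr Nt) (n : Fin N) (A : Finset s.Element) : ℝ :=
  A.powerset.inf' ⟨∅, Finset.empty_mem_powerset A⟩ fun R =>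
    s.logDet n (A \ R) + ∑ e ∈ R, (Nt : ℝ) * Real.log ((s.constellation e).card : ℝ)

/-- `g(A) = ∑_n g^{(n)}(A)`. -/
def System.g (s : System K N Nr Nt) (A : Finset s.Element) : ℝ :=
  ∑ n, s.gRB n A

open Classical in
/-- Rank functions: nonnegative, normalized, monotone and submodular set functions. -/
structure IsRankFunction {E : Type*} (f : Finset E → ℝ) : Prop where
  nonneg : ∀ A, 0 ≤ f A
  normalized : f ∅ = 0
  monotone : ∀ A B, A ⊆ B → f A ≤ f B
  submodular : ∀ A B, A ⊆ B → ∀ e, f (B ∪ {e}) - f B ≤ f (A ∪ {e}) - f A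

end Uplink

end

/-! Information bound. Fix `R ⊆ A`, let `f x` be the true channel density and let `q x` be the
Gaussian density with covariance `S = 1 + signalCov (A \ R)`, centred at the signal in which the
symbols outside `R` are replaced by their means. Write `f̄`, `q̄` for the averages over the input.
As `q` depends only on the symbols in `R`, which are uniform on `M = ∏_{e ∈ R} S_e^{Nt}` values, `q
≤ M q̄`. Split `log (f/f̄) = log M + log (f/q) + log (q/(M f̄))`. By `log t ≤ t - 1` the last term
has nonpositive mean, because `E[q/(M f̄)] ≤ ∫ q̄ = 1`. The middle term has mean `log det S + E[u†
S⁻¹ u] - Nr`, where `u` is the deviation of the output from the centre of `q`; the covariance of `u`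
is at most `S`, so this is at most `log det S`. No separate chain rule or maximum entropy theorem is
needed. The carriers are `klDiv_withDensity_le`, `integral_hermForm_le`,
`System.ae_le_card_mul_integral` and `System.info_le`.

Rank function. `logDet` is monotone and submodular since `det (X + F F†) / det X = det (1 + F† X⁻¹
F)` is at least 1 and decreases as `X` grows. Minimizing over splittings of `A` against a
nonnegative additive weight preserves both properties (`minConv_mono`,
`minConv_union_add_inter_le`), and so does summation over the RBs. -/

namespace Uplink

/-! ### Monotonicity and submodularity of the log-determinant -/

section LogDet

open scoped ComplexOrder MatrixOrder

variable {m : Type*} [Fintype m] [DecidableEq m]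

lemma exists_eq_mul_conjTranspose {E : Matrix m m ℂ} (hE : E.PosSemidef) :
    ∃ F : Matrix m m ℂ, E = F * Fᴴ := by
  obtain ⟨B, rfl⟩ := CStarAlgebra.nonneg_iff_eq_star_mul_self.mp hE.nonneg
  exact ⟨star B, by simp [star_eq_conjTranspose]⟩

/-- Each eigenvalue is the Rayleigh quotient of `1 + Q` at a unit eigenvector, hence 1 plus a
nonnegative number. -/
lemma one_le_det_one_add {Q : Matrix m m ℂ} (hQ : Q.PosSemidef) : 1 ≤ (1 + Q).det := by
  have hH : (1 + Q).IsHermitian := isHermitian_one.add hQ.1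
  rw [hH.det_eq_prod_eigenvalues]
  have key : ∀ i, 1 ≤ hH.eigenvalues i := by
    intro i
    rw [hH.eigenvalues_eq, add_mulVec, one_mulVec, dotProduct_add]
    have h1 : star ⇑(hH.eigenvectorBasis i) ⬝ᵥ ⇑(hH.eigenvectorBasis i) = (1 : ℂ) := by
      rw [dotProduct_comm, ← EuclideanSpace.inner_eq_star_dotProduct]
      simp [inner_self_eq_norm_sq_to_K, hH.eigenvectorBasis.orthonormal.1 i]
    have h2 := hQ.re_dotProduct_nonneg ⇑(hH.eigenvectorBasis i)
    rw [h1, map_add]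
    simpa using h2
  have : (1 : ℝ) ≤ ∏ i, hH.eigenvalues i := Finset.one_le_prod fun i _ => key i
  calc (1 : ℂ) = ((1 : ℝ) : ℂ) := by simp
    _ ≤ ((∏ i, hH.eigenvalues i : ℝ) : ℂ) := Complex.real_le_real.2 this
    _ = _ := by simp

lemma det_le_det_add {P Z : Matrix m m ℂ} (hP : P.PosDef) (hZ : Z.PosSemidef) :
    P.det ≤ (P + Z).det := by
  obtain ⟨F, rfl⟩ := exists_eq_mul_conjTranspose hZ
  rw [det_add_mul _ _ hP.det_pos.ne'.isUnit]
  have := one_le_det_one_add (hP.inv.posSemidef.conjTranspose_mul_mul_same F)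
  simpa using mul_le_mul_of_nonneg_left this hP.det_pos.le

/-- With `Y = X + Z`, the difference equals `Y⁻¹ (Z + Z X⁻¹ Z) Y⁻¹`, a congruence of a visibly
positive semidefinite matrix. -/
lemma posSemidef_inv_sub_inv_add {X Z : Matrix m m ℂ} (hX : X.PosDef) (hZ : Z.PosSemidef) :
    (X⁻¹ - (X + Z)⁻¹).PosSemidef := by
  have hY : (X + Z).PosDef := hX.add_posSemidef hZ
  have h1 : (Z + Z * X⁻¹ * Z).PosSemidef := by
    have := hX.inv.posSemidef.conjTranspose_mul_mul_same Z
    rw [hZ.1.eq] at this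
    exact hZ.add this
  have h2 := h1.conjTranspose_mul_mul_same (X + Z)⁻¹
  rw [hY.inv.1.eq] at h2
  have hXu := hX.isUnit
  have hYu := hY.isUnit
  rw [isUnit_iff_isUnit_det] at hXu hYu
  have h3 : Z + Z * X⁻¹ * Z = (X + Z) * X⁻¹ * Z := by
    rw [add_mul, add_mul, mul_nonsing_inv _ hXu, one_mul]
  have h4 : (X + Z)⁻¹ * (Z + Z * X⁻¹ * Z) * (X + Z)⁻¹ = X⁻¹ - (X + Z)⁻¹ := by
    rw [h3, mul_assoc (X + Z), nonsing_inv_mul_cancel_left _ _ hYu]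
    have : X⁻¹ * Z = X⁻¹ * (X + Z) - 1 := by
      rw [mul_add, nonsing_inv_mul _ hXu]; abel
    rw [this, sub_mul, mul_nonsing_inv_cancel_right _ _ hYu, one_mul]
  rwa [h4] at h2

/-- Diminishing returns in multiplicative form: for `E = F F†` the determinant lemma turns both
ratios into `det (1 + F† · F)` evaluated at `X⁻¹` and `(X + Z)⁻¹`, and inversion reverses the
Loewner order. -/
lemma det_add_add_mul_det_le {X Z E : Matrix m m ℂ} (hX : X.PosDef) (hZ : Z.PosSemidef)
    (hE : E.PosSemidef) : (X + Z + E).det * X.det ≤ (X + E).det * (X + Z).det := by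
  obtain ⟨F, rfl⟩ := exists_eq_mul_conjTranspose hE
  have hY : (X + Z).PosDef := hX.add_posSemidef hZ
  rw [det_add_mul _ _ hX.det_pos.ne'.isUnit, det_add_mul _ _ hY.det_pos.ne'.isUnit]
  have h1 := (posSemidef_inv_sub_inv_add hX hZ).conjTranspose_mul_mul_same F
  have h2 : (1 + Fᴴ * (X + Z)⁻¹ * F).PosDef :=
    PosDef.one.add_posSemidef (hY.inv.posSemidef.conjTranspose_mul_mul_same F)
  have h3 := det_le_det_add h2 h1
  have h4 : 1 + Fᴴ * (X + Z)⁻¹ * F + Fᴴ * (X⁻¹ - (X + Z)⁻¹) * F = 1 + Fᴴ * X⁻¹ * F := by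
    rw [mul_sub, sub_mul]; abel
  rw [h4] at h3
  calc _ = (X.det * (X + Z).det) * (1 + Fᴴ * (X + Z)⁻¹ * F).det := by ring
    _ ≤ (X.det * (X + Z).det) * (1 + Fᴴ * X⁻¹ * F).det :=
      mul_le_mul_of_nonneg_left h3 (mul_nonneg hX.det_pos.le hY.det_pos.le)
    _ = _ := by ring

lemma re_det_pos {X : Matrix m m ℂ} (hX : X.PosDef) : 0 < X.det.re :=
  (Complex.lt_def.1 hX.det_pos).1

/-- Positivity in the order on `ℂ` includes a vanishing imaginary part, so nothing is lost by
passing to real parts. -/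
lemma ofReal_re_det {X : Matrix m m ℂ} (hX : X.PosDef) : ((X.det.re : ℝ) : ℂ) = X.det :=
  Complex.ext rfl (Complex.lt_def.1 hX.det_pos).2

lemma log_det_le_log_det_add {P Z : Matrix m m ℂ} (hP : P.PosDef) (hZ : Z.PosSemidef) :
    Real.log P.det.re ≤ Real.log (P + Z).det.re :=
  Real.log_le_log (re_det_pos hP) (Complex.le_def.1 (det_le_det_add hP hZ)).1

lemma log_det_add_add_le {X Z E : Matrix m m ℂ} (hX : X.PosDef) (hZ : Z.PosSemidef)
    (hE : E.PosSemidef) :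
    Real.log (X + Z + E).det.re + Real.log X.det.re ≤
      Real.log (X + E).det.re + Real.log (X + Z).det.re := by
  have hXZ := hX.add_posSemidef hZ
  have hXE := hX.add_posSemidef hE
  have hXZE := hXZ.add_posSemidef hE
  rw [← Real.log_mul (re_det_pos hXZE).ne' (re_det_pos hX).ne',
    ← Real.log_mul (re_det_pos hXE).ne' (re_det_pos hXZ).ne']
  refine Real.log_le_log (mul_pos (re_det_pos hXZE) (re_det_pos hX)) ?_
  have := det_add_add_mul_det_le hX hZ hE
  rw [← ofReal_re_det hX, ← ofReal_re_det hXZ, ← ofReal_re_det hXE, ← ofReal_re_det hXZE] at this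
  exact_mod_cast this

end LogDet

/-! ### Convolution of a set function with an additive weight -/

section MinConvolution

variable {E : Type*} [DecidableEq E]

/-- The convolution of a set function with an additive one. -/
noncomputable def minConv (f : Finset E → ℝ) (w : E → ℝ) (A : Finset E) : ℝ :=
  A.powerset.inf' ⟨∅, Finset.empty_mem_powerset A⟩ fun R => f (A \ R) + ∑ e ∈ R, w e

/-- The minimum is reparametrized by the kept set `S = A \ R`, for which unions and intersections
behave well. -/
lemma minConv_le (f : Finset E → ℝ) (w : E → ℝ) {A S : Finset E} (hS : S ⊆ A) :
    minConv f w A ≤ f S + ∑ e ∈ A, w e - ∑ e ∈ S, w e := by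
  have h := Finset.inf'_le (fun R => f (A \ R) + ∑ e ∈ R, w e)
    (Finset.mem_powerset.2 (Finset.sdiff_subset : A \ S ⊆ A))
  have h1 := Finset.sum_sdiff (f := w) hS
  simp only [Finset.sdiff_sdiff_eq_self hS] at h
  unfold minConv
  linarith

lemma exists_minConv_eq (f : Finset E → ℝ) (w : E → ℝ) (A : Finset E) :
    ∃ S ⊆ A, minConv f w A = f S + ∑ e ∈ A, w e - ∑ e ∈ S, w e := by
  obtain ⟨R, hR, h⟩ := Finset.exists_mem_eq_inf' (⟨∅, Finset.empty_mem_powerset A⟩ :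
    A.powerset.Nonempty) (fun R => f (A \ R) + ∑ e ∈ R, w e)
  refine ⟨A \ R, Finset.sdiff_subset, ?_⟩
  have h1 := Finset.sum_sdiff (f := w) (Finset.mem_powerset.1 hR)
  unfold minConv
  rw [h]
  linarith

/-- If `S` and `T` are optimal for `A` and `B`, then `S ∪ T` and `S ∩ T` are admissible for `A ∪ B`
and `A ∩ B`, and the additive weights balance exactly. -/
lemma minConv_union_add_inter_le {f : Finset E → ℝ} (w : E → ℝ)
    (hf : ∀ S T, f (S ∪ T) + f (S ∩ T) ≤ f S + f T) (A B : Finset E) :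
    minConv f w (A ∪ B) + minConv f w (A ∩ B) ≤ minConv f w A + minConv f w B := by
  obtain ⟨S, hS, hS'⟩ := exists_minConv_eq f w A
  obtain ⟨T, hT, hT'⟩ := exists_minConv_eq f w B
  have h1 := minConv_le f w (Finset.union_subset_union hS hT)
  have h2 := minConv_le f w (Finset.inter_subset_inter hS hT)
  have h3 := Finset.sum_union_inter (s₁ := A) (s₂ := B) (f := w)
  have h4 := Finset.sum_union_inter (s₁ := S) (s₂ := T) (f := w)
  have h5 := hf S T
  linarith

/-- An optimal `T` for `B` is cut down to `T ∩ A`; the weight charged on `A \ T` is at most that on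
`B \ T`. -/
lemma minConv_mono {f : Finset E → ℝ} {w : E → ℝ} (hf : ∀ S T, S ⊆ T → f S ≤ f T)
    (hw : ∀ e, 0 ≤ w e) {A B : Finset E} (hAB : A ⊆ B) : minConv f w A ≤ minConv f w B := by
  obtain ⟨T, hT, hT'⟩ := exists_minConv_eq f w B
  have h1 := minConv_le f w (Finset.inter_subset_right : T ∩ A ⊆ A)
  have h2 := hf (T ∩ A) T Finset.inter_subset_left
  have h3 := Finset.sum_union_inter (s₁ := T) (s₂ := A) (f := w)
  have h4 := Finset.sum_le_sum_of_subset_of_nonneg (f := w) (Finset.union_subset hT hAB)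
    (fun e _ _ => hw e)
  linarith

lemma minConv_empty {f : Finset E → ℝ} (w : E → ℝ) (hf : f ∅ = 0) : minConv f w ∅ = 0 := by
  simp [minConv, hf]

end MinConvolution

/-! ### `g` is a rank function -/

section RankFunction

variable {K N Nr Nt : ℕ} (s : System K N Nr Nt)

lemma System.alloc_nonneg (e : s.Element) (n : Fin N) : 0 ≤ s.alloc e n := Nat.cast_nonneg _

/-- The zero assignment is covered too: division by zero gives `0`, the prescribed value of `p_e`.
-/
lemma System.psd_nonneg (hb : ∀ k, 0 ≤ s.budget k) (e : s.Element) : 0 ≤ s.psd e :=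
  div_nonneg (hb _) (Finset.sum_nonneg fun n _ => s.alloc_nonneg e n)

/-- The signal covariance `∑_{e ∈ A} p_e c_e(n) H_e W_e (H_e W_e)†`. -/
noncomputable def System.signalCov (n : Fin N) (A : Finset s.Element) :
    Matrix (Fin Nr) (Fin Nr) ℂ :=
  ∑ e ∈ A, ((s.psd e * s.alloc e n : ℝ) : ℂ) • (s.effChannel n e * (s.effChannel n e)ᴴ)

open scoped ComplexOrder MatrixOrder

lemma System.signalCov_posSemidef (hb : ∀ k, 0 ≤ s.budget k) (n : Fin N) (A : Finset s.Element) :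
    (s.signalCov n A).PosSemidef := by
  refine posSemidef_sum _ fun e _ => (posSemidef_self_mul_conjTranspose _).smul ?_
  exact_mod_cast mul_nonneg (s.psd_nonneg hb e) (s.alloc_nonneg e n)

lemma System.one_add_signalCov_posDef (hb : ∀ k, 0 ≤ s.budget k) (n : Fin N)
    (A : Finset s.Element) : (1 + s.signalCov n A).PosDef :=
  PosDef.one.add_posSemidef (s.signalCov_posSemidef hb n A)

open Classical in
lemma System.logDet_mono (hb : ∀ k, 0 ≤ s.budget k) (n : Fin N) (S T : Finset s.Element)
    (h : S ⊆ T) : s.logDet n S ≤ s.logDet n T := by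
  have h1 := log_det_le_log_det_add (s.one_add_signalCov_posDef hb n S)
    (s.signalCov_posSemidef hb n (T \ S))
  have h2 : s.signalCov n S + s.signalCov n (T \ S) = s.signalCov n T := by
    rw [add_comm]; exact Finset.sum_sdiff h
  rwa [add_assoc, h2] at h1

open Classical in
lemma System.logDet_union_add_inter_le (hb : ∀ k, 0 ≤ s.budget k) (n : Fin N)
    (S T : Finset s.Element) :
    s.logDet n (S ∪ T) + s.logDet n (S ∩ T) ≤ s.logDet n S + s.logDet n T := by
  -- The base point is `S ∩ T`; the two increments are the one-sided differences.
  have h1 := log_det_add_add_le (s.one_add_signalCov_posDef hb n (S ∩ T))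
    (s.signalCov_posSemidef hb n (T \ S)) (s.signalCov_posSemidef hb n (S \ T))
  have hT : s.signalCov n (S ∩ T) + s.signalCov n (T \ S) = s.signalCov n T := by
    rw [Finset.inter_comm]; exact Finset.sum_inter_add_sum_sdiff T S _
  have hS : s.signalCov n (S ∩ T) + s.signalCov n (S \ T) = s.signalCov n S :=
    Finset.sum_inter_add_sum_sdiff S T _
  have hU : s.signalCov n T + s.signalCov n (S \ T) = s.signalCov n (S ∪ T) := by
    rw [← Finset.sdiff_union_self_eq_union]
    exact (add_comm _ _).trans (Finset.sum_union Finset.sdiff_disjoint).symm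
  rwa [add_assoc 1, hT, add_assoc 1, hU, add_assoc 1, hS] at h1

lemma System.logDet_empty (n : Fin N) : s.logDet n ∅ = 0 := by
  simp [System.logDet]

open Classical in
lemma System.gRB_eq_minConv (n : Fin N) (A : Finset s.Element) :
    s.gRB n A =
      minConv (s.logDet n) (fun e => (Nt : ℝ) * Real.log ((s.constellation e).card : ℝ)) A := rfl

lemma System.g_isRankFunction (hb : ∀ k, 0 ≤ s.budget k) : IsRankFunction s.g := by
  classical
  have hw : ∀ e : s.Element, 0 ≤ (Nt : ℝ) * Real.log ((s.constellation e).card : ℝ) := fun e =>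
    mul_nonneg (Nat.cast_nonneg _) (Real.log_natCast_nonneg _)
  have hempty : s.g ∅ = 0 :=
    Finset.sum_eq_zero fun n _ => by
      rw [s.gRB_eq_minConv, minConv_empty _ (s.logDet_empty n)]
  have hmono : ∀ A B, A ⊆ B → s.g A ≤ s.g B := fun A B h =>
    Finset.sum_le_sum fun n _ => by
      simp only [s.gRB_eq_minConv]
      exact minConv_mono (s.logDet_mono hb n) hw h
  have hsub : ∀ A B, s.g (A ∪ B) + s.g (A ∩ B) ≤ s.g A + s.g B := fun A B => by
    simp only [System.g, ← Finset.sum_add_distrib]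
    refine Finset.sum_le_sum fun n _ => ?_
    simp only [s.gRB_eq_minConv]
    exact minConv_union_add_inter_le _ (s.logDet_union_add_inter_le hb n) A B
  refine ⟨fun A => hempty ▸ hmono ∅ A (Finset.empty_subset A), hempty, hmono, ?_⟩
  intro A B hAB e
  have h1 := hsub (A ∪ {e}) B
  have h2 : A ∪ {e} ∪ B = B ∪ {e} := by grind
  -- The intersection is `A` if `e ∉ B` and `A ∪ {e}` otherwise; monotonicity handles both cases at
  -- once.
  have h3 := hmono A ((A ∪ {e}) ∩ B) (by grind)
  rw [h2] at h1
  convert (by linarith : s.g (B ∪ {e}) - s.g B ≤ s.g (A ∪ {e}) - s.g A)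

end RankFunction


/-! ### Bounding mutual information through an auxiliary channel -/

section InformationBound

open InformationTheory

variable {𝓧 𝓨 : Type*} [MeasurableSpace 𝓧] [MeasurableSpace 𝓨]
  {μ : Measure 𝓧} [IsProbabilityMeasure μ] {lam : Measure 𝓨} [SigmaFinite lam]
  {f q : 𝓧 → 𝓨 → ℝ}

lemma integrable_section {D : ℝ} (hf : Measurable (Function.uncurry f))
    (hf0 : ∀ x y, 0 < f x y) (hfD : ∀ x y, f x y ≤ D) (y : 𝓨) :
    Integrable (fun x => f x y) μ := by
  refine Integrable.of_bound (hf.comp measurable_prodMk_right).aestronglyMeasurable D ?_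
  exact Filter.Eventually.of_forall fun x => by
    rw [Real.norm_of_nonneg (hf0 x y).le]; exact hfD x y

lemma integral_section_pos {D : ℝ} (hf : Measurable (Function.uncurry f))
    (hf0 : ∀ x y, 0 < f x y) (hfD : ∀ x y, f x y ≤ D) (y : 𝓨) :
    0 < ∫ x, f x y ∂μ := by
  rw [integral_pos_iff_support_of_nonneg (fun x => (hf0 x y).le)
    (integrable_section hf hf0 hfD y)]
  have : Function.support (fun x => f x y) = Set.univ := by
    ext x; simp [(hf0 x y).ne']
  rw [this]; simp

lemma ofReal_integral_section {D : ℝ} (hf : Measurable (Function.uncurry f))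
    (hf0 : ∀ x y, 0 < f x y) (hfD : ∀ x y, f x y ≤ D) (y : 𝓨) :
    ENNReal.ofReal (∫ x, f x y ∂μ) = ∫⁻ x, ENNReal.ofReal (f x y) ∂μ :=
  ofReal_integral_eq_lintegral_ofReal (integrable_section hf hf0 hfD y)
    (Filter.Eventually.of_forall fun x => (hf0 x y).le)

lemma measurable_integral_section (hf : Measurable (Function.uncurry f)) :
    Measurable fun y => ∫ x, f x y ∂μ := by
  have : StronglyMeasurable (Function.uncurry fun y x => f x y) :=
    (hf.comp measurable_swap).stronglyMeasurable
  exact this.integral_prod_right.measurable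

/-- The information of a channel with input law `μ` and transition densities `f`, bounded by
comparing the output law with the mixture of the densities `q`. -/
theorem klDiv_withDensity_le {D D' C M : ℝ}
    (hf : Measurable (Function.uncurry f)) (hq : Measurable (Function.uncurry q))
    (hf0 : ∀ x y, 0 < f x y) (hq0 : ∀ x y, 0 < q x y)
    (hfD : ∀ x y, f x y ≤ D) (hqD : ∀ x y, q x y ≤ D')
    (hf1 : ∀ x, ∫⁻ y, ENNReal.ofReal (f x y) ∂lam = 1)
    (hq1 : ∀ x, ∫⁻ y, ENNReal.ofReal (q x y) ∂lam = 1)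
    (hfC : ∀ᵐ x ∂μ, ∀ y, f x y ≤ C * ∫ x', f x' y ∂μ)
    (hM : 0 < M) (hqM : ∀ᵐ x ∂μ, ∀ y, q x y ≤ M * ∫ x', q x' y ∂μ)
    {P : Measure (𝓧 × 𝓨)}
    (hP : P = (μ.prod lam).withDensity fun z => ENNReal.ofReal (f z.1 z.2))
    (hint : Integrable (fun z => Real.log (f z.1 z.2 / q z.1 z.2)) P) :
    klDiv P (μ.prod (P.map Prod.snd)) ≤
      ENNReal.ofReal (Real.log M + ∫ z, Real.log (f z.1 z.2 / q z.1 z.2) ∂P) := by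
  set fb : 𝓨 → ℝ := fun y => ∫ x, f x y ∂μ with hfb
  set qb : 𝓨 → ℝ := fun y => ∫ x, q x y ∂μ with hqb
  have hfb0 : ∀ y, 0 < fb y := integral_section_pos hf hf0 hfD
  have hfbm : Measurable fb := measurable_integral_section hf
  have hfm : Measurable fun z : 𝓧 × 𝓨 => f z.1 z.2 := hf
  have hqm : Measurable fun z : 𝓧 × 𝓨 => q z.1 z.2 := hq
  have hPprob : IsProbabilityMeasure P := by
    constructor
    rw [hP, withDensity_apply _ MeasurableSet.univ, setLIntegral_univ,
      lintegral_prod _ hfm.ennreal_ofReal.aemeasurable]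
    simp [hf1]
  -- The output law has the mixture `fb` as its density.
  have hout : P.map Prod.snd = lam.withDensity fun y => ENNReal.ofReal (fb y) := by
    ext t ht
    rw [Measure.map_apply measurable_snd ht, hP, withDensity_apply _ (measurable_snd ht),
      withDensity_apply _ ht, ← lintegral_indicator (measurable_snd ht),
      lintegral_prod_symm _ (hfm.ennreal_ofReal.indicator (measurable_snd ht)).aemeasurable,
      ← lintegral_indicator ht]
    refine lintegral_congr fun y => ?_
    by_cases hy : y ∈ t
    · simp only [Set.indicator, Set.mem_preimage, hy, if_true]
      exact (ofReal_integral_section hf hf0 hfD y).symm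
    · simp [Set.indicator, hy]
  have houtprob : IsProbabilityMeasure (P.map Prod.snd) :=
    Measure.isProbabilityMeasure_map measurable_snd.aemeasurable
  set Q : Measure (𝓧 × 𝓨) := μ.prod (P.map Prod.snd) with hQ
  have hQd : Q = (μ.prod lam).withDensity fun z => ENNReal.ofReal (fb z.2) := by
    rw [hQ, hout]
    exact prod_withDensity_right hfbm.ennreal_ofReal
  have hdm : Measurable fun z : 𝓧 × 𝓨 => f z.1 z.2 / fb z.2 :=
    hfm.div (hfbm.comp measurable_snd)
  have hPQ : P = Q.withDensity fun z => ENNReal.ofReal (f z.1 z.2 / fb z.2) := by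
    have hm : Measurable fun z : 𝓧 × 𝓨 => ENNReal.ofReal (fb z.2) :=
      (hfbm.comp measurable_snd).ennreal_ofReal
    rw [hQd, ← withDensity_mul _ hm hdm.ennreal_ofReal, hP]
    congr 1
    ext z
    rw [Pi.mul_apply, ← ENNReal.ofReal_mul (hfb0 _).le, mul_div_cancel₀ _ (hfb0 _).ne']
  have hac : P ≪ Q := by
    rw [hPQ]; exact withDensity_absolutelyContinuous _ _
  have hrn : P.rnDeriv Q =ᵐ[Q] fun z => ENNReal.ofReal (f z.1 z.2 / fb z.2) := by
    conv_lhs => rw [hPQ]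
    exact Measure.rnDeriv_withDensity _ hdm.ennreal_ofReal
  have hd0 : ∀ z : 𝓧 × 𝓨, 0 < f z.1 z.2 / fb z.2 := fun z => div_pos (hf0 _ _) (hfb0 _)
  -- The constant `C` only serves integrability: it bounds the likelihood ratio, and `klFun` is
  -- bounded on `[0, C]`.
  have hbdd : ∀ᵐ z ∂Q, f z.1 z.2 / fb z.2 ≤ C := by
    have h : ∀ᵐ x ∂(Q.map Prod.fst), ∀ y, f x y ≤ C * fb y := by
      rw [hQ, Measure.map_fst_prod]; simpa using hfC
    filter_upwards [ae_of_ae_map measurable_fst.aemeasurable h] with z hz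
    rw [div_le_iff₀ (hfb0 _)]
    exact hz z.2
  have hllr : Integrable (llr P Q) P := by
    rw [← integrable_klFun_rnDeriv_iff hac]
    obtain ⟨B, hB⟩ := (isCompact_Icc (a := (0 : ℝ)) (b := C)).exists_bound_of_continuousOn
      continuous_klFun.continuousOn
    refine Integrable.of_bound
      (measurable_klFun.comp (Measure.measurable_rnDeriv P Q).ennreal_toReal).aestronglyMeasurable
      B ?_
    filter_upwards [hrn, hbdd] with z h1 h2
    rw [h1, ENNReal.toReal_ofReal (hd0 z).le]
    exact hB _ ⟨(hd0 z).le, h2⟩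
  have hllr' : llr P Q =ᵐ[P] fun z => Real.log (f z.1 z.2 / fb z.2) := by
    filter_upwards [hac.ae_le hrn] with z hz
    rw [llr, hz, ENNReal.toReal_ofReal (hd0 z).le]
  have hrm : Measurable fun z : 𝓧 × 𝓨 => q z.1 z.2 / (M * fb z.2) :=
    hqm.div ((hfbm.comp measurable_snd).const_mul M)
  have hr0 : ∀ z : 𝓧 × 𝓨, 0 < q z.1 z.2 / (M * fb z.2) := fun z =>
    div_pos (hq0 _ _) (mul_pos hM (hfb0 _))
  have hqb1 : ∫⁻ y, ENNReal.ofReal (qb y) ∂lam = 1 := by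
    simp only [hqb, ofReal_integral_section hq hq0 hqD]
    rw [lintegral_lintegral_swap (hqm.comp measurable_swap).ennreal_ofReal.aemeasurable]
    simp [hq1]
  -- Replacing `q / M` by the larger `qb` makes the ratio independent of `x`; integrating `f` over
  -- `x` then cancels `fb` and leaves `∫ qb = 1`.
  have hr1 : ∫⁻ z, ENNReal.ofReal (q z.1 z.2 / (M * fb z.2)) ∂P ≤ 1 := by
    rw [hP, lintegral_withDensity_eq_lintegral_mul _ hfm.ennreal_ofReal hrm.ennreal_ofReal,
      lintegral_prod_symm _ (hfm.ennreal_ofReal.mul hrm.ennreal_ofReal).aemeasurable, ← hqb1]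
    refine lintegral_mono fun y => ?_
    simp only [Pi.mul_apply]
    calc ∫⁻ x, ENNReal.ofReal (f x y) * ENNReal.ofReal (q x y / (M * fb y)) ∂μ
        ≤ ∫⁻ x, ENNReal.ofReal (f x y) * ENNReal.ofReal (qb y / fb y) ∂μ := by
          refine lintegral_mono_ae ?_
          filter_upwards [hqM] with x hx
          refine mul_le_mul' le_rfl (ENNReal.ofReal_le_ofReal ?_)
          rw [div_le_div_iff₀ (mul_pos hM (hfb0 y)) (hfb0 y)]
          nlinarith [hx y, hfb0 y]
      _ = ENNReal.ofReal (qb y) := by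
          have hm : Measurable fun x => ENNReal.ofReal (f x y) :=
            (hfm.comp measurable_prodMk_right).ennreal_ofReal
          rw [lintegral_mul_const _ hm,
            ← ofReal_integral_section hf hf0 hfD, ← ENNReal.ofReal_mul (hfb0 y).le]
          exact congrArg _ (mul_div_cancel₀ _ (hfb0 y).ne')
  have hrint : Integrable (fun z : 𝓧 × 𝓨 => q z.1 z.2 / (M * fb z.2)) P := by
    refine ⟨hrm.aestronglyMeasurable, ?_⟩
    rw [hasFiniteIntegral_iff_ofReal (Filter.Eventually.of_forall fun z => (hr0 z).le)]
    exact hr1.trans_lt ENNReal.one_lt_top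
  have hrle : ∫ z, q z.1 z.2 / (M * fb z.2) ∂P ≤ 1 := by
    rw [integral_eq_lintegral_of_nonneg_ae (Filter.Eventually.of_forall fun z => (hr0 z).le)
      hrm.aestronglyMeasurable]
    exact ENNReal.toReal_le_of_le_ofReal zero_le_one (by simpa using hr1)
  rw [klDiv_of_ac_of_integrable hac hllr]
  refine ENNReal.ofReal_le_ofReal ?_
  have hQprob : IsProbabilityMeasure Q := by rw [hQ]; infer_instance
  rw [probReal_univ, probReal_univ, add_sub_cancel_right, integral_congr_ae hllr']
  have hint₁ : Integrable (fun z => Real.log M + Real.log (f z.1 z.2 / q z.1 z.2)) P :=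
    (integrable_const _).add hint
  have hint₂ : Integrable (fun z => q z.1 z.2 / (M * fb z.2) - 1) P :=
    hrint.sub (integrable_const _)
  -- The three-term splitting of `log (f / fb)`, with `log t ≤ t - 1` applied at `t = q / (M fb)`.
  have hle : ∫ z, Real.log (f z.1 z.2 / fb z.2) ∂P ≤
      ∫ z, (Real.log M + Real.log (f z.1 z.2 / q z.1 z.2)) + (q z.1 z.2 / (M * fb z.2) - 1) ∂P := by
    refine integral_mono (hllr.congr hllr') (hint₁.add hint₂) fun z => ?_
    have h1 := Real.log_le_sub_one_of_pos (hr0 z)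
    rw [Real.log_div (hq0 _ _).ne' (mul_pos hM (hfb0 _)).ne',
      Real.log_mul hM.ne' (hfb0 _).ne'] at h1
    simp only [Real.log_div (hf0 _ _).ne' (hfb0 _).ne', Real.log_div (hf0 _ _).ne' (hq0 _ _).ne']
    linarith
  rw [integral_add hint₁ hint₂,
    integral_add (integrable_const _) hint, integral_sub hrint (integrable_const _)] at hle
  simp only [integral_const, probReal_univ, one_smul] at hle
  linarith

end InformationBound


/-! ### Complex Gaussian densities -/

section GaussianDensity

open scoped ComplexOrder MatrixOrder

lemma pi_withDensity_ofReal {ι E : Type*} [Fintype ι] [MeasureSpace E]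
    [SigmaFinite (volume : Measure E)] {φ : E → ℝ} (hφ : Integrable φ) (hφ0 : ∀ x, 0 ≤ φ x) :
    Measure.pi (fun _ : ι => (volume : Measure E).withDensity fun x => ENNReal.ofReal (φ x)) =
      (volume : Measure (ι → E)).withDensity fun y => ENNReal.ofReal (∏ i, φ (y i)) := by
  have hfin : IsFiniteMeasure ((volume : Measure E).withDensity fun x => ENNReal.ofReal (φ x)) :=
    isFiniteMeasure_withDensity_ofReal hφ.2
  refine Measure.pi_eq fun s hs => ?_
  rw [withDensity_apply _ (MeasurableSet.univ_pi hs), volume_pi, Measure.restrict_pi_pi,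
    ← ofReal_integral_eq_lintegral_ofReal
      (Integrable.fintype_prod fun i => hφ.restrict)
      (Filter.Eventually.of_forall fun y => Finset.prod_nonneg fun i _ => hφ0 _),
    integral_fintype_prod_eq_prod (fun _ => φ),
    ENNReal.ofReal_prod_of_nonneg fun i _ => integral_nonneg hφ0]
  refine Finset.prod_congr rfl fun i _ => ?_
  rw [withDensity_apply _ (hs i), ofReal_integral_eq_lintegral_ofReal hφ.restrict
    (Filter.Eventually.of_forall hφ0)]

/-- The density of the law `CN(0, 1)`. -/
noncomputable def complexGaussianPDF (z : ℂ) : ℝ := Real.pi⁻¹ * Real.exp (-‖z‖ ^ 2)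

lemma complexGaussianPDF_nonneg (z : ℂ) : 0 ≤ complexGaussianPDF z := by
  unfold complexGaussianPDF; positivity

lemma measurable_complexGaussianPDF : Measurable complexGaussianPDF := by
  unfold complexGaussianPDF; fun_prop

lemma complexGaussian_eq_withDensity :
    complexGaussian =
      (volume : Measure ℂ).withDensity fun z => ENNReal.ofReal (complexGaussianPDF z) := by
  have hv : (1 / 2 : NNReal) ≠ 0 := by norm_num
  have hmap : (fun z : ℝ × ℝ => (⟨z.1, z.2⟩ : ℂ)) = Complex.measurableEquivRealProd.symm := rfl
  rw [complexGaussian, gaussianReal_of_var_ne_zero 0 hv,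
    prod_withDensity (measurable_gaussianPDF _ _) (measurable_gaussianPDF _ _), hmap]
  ext t ht
  rw [MeasurableEquiv.map_apply, withDensity_apply _ (MeasurableEquiv.measurable _ ht),
    withDensity_apply _ ht,
    ← Complex.volume_preserving_equiv_real_prod.symm.setLIntegral_comp_preimage_emb
      (MeasurableEquiv.measurableEmbedding _)]
  refine lintegral_congr fun z => ?_
  rw [gaussianPDF, gaussianPDF, ← ENNReal.ofReal_mul (gaussianPDFReal_nonneg _ _ _)]
  congr 1
  -- Variance `1/2` per real component makes the normalization `π` and the exponent `-‖z‖²`.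
  have h2 : (2 * Real.pi * ((1 / 2 : NNReal) : ℝ)) = Real.pi := by push_cast; ring
  have h3 : (2 * ((1 / 2 : NNReal) : ℝ)) = 1 := by push_cast; ring
  simp only [gaussianPDFReal, complexGaussianPDF, h2, h3,
    Complex.measurableEquivRealProd_symm_apply]
  rw [Complex.sq_norm, Complex.normSq_mk, mul_mul_mul_comm, ← mul_inv,
    Real.mul_self_sqrt Real.pi_pos.le, ← Real.exp_add]
  congr 2
  ring

instance : IsProbabilityMeasure complexGaussian := by
  have hmap : (fun z : ℝ × ℝ => (⟨z.1, z.2⟩ : ℂ)) = Complex.measurableEquivRealProd.symm := rfl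
  rw [complexGaussian, hmap]
  exact Measure.isProbabilityMeasure_map (MeasurableEquiv.measurable _).aemeasurable

instance (Nr : ℕ) : IsProbabilityMeasure (noiseLaw Nr) := by
  unfold noiseLaw; infer_instance

lemma integrable_complexGaussianPDF : Integrable complexGaussianPDF := by
  refine ⟨measurable_complexGaussianPDF.aestronglyMeasurable, ?_⟩
  rw [hasFiniteIntegral_iff_ofReal (Filter.Eventually.of_forall complexGaussianPDF_nonneg)]
  have h := measure_univ (μ := complexGaussian)
  rw [complexGaussian_eq_withDensity, withDensity_apply _ MeasurableSet.univ,
    setLIntegral_univ] at h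
  rw [h]; exact ENNReal.one_lt_top

variable {r : ℕ}

/-- The Hermitian form `y† T y`. -/
noncomputable def hermForm (T : Matrix (Fin r) (Fin r) ℂ) (y : Fin r → ℂ) : ℝ :=
  (star y ⬝ᵥ (T *ᵥ y)).re

lemma hermForm_one (y : Fin r → ℂ) : hermForm 1 y = ∑ i, ‖y i‖ ^ 2 := by
  simp only [hermForm, one_mulVec, dotProduct, Complex.re_sum, Pi.star_apply]
  refine Finset.sum_congr rfl fun i _ => ?_
  rw [Complex.star_def, Complex.conj_mul']
  norm_cast

lemma continuous_hermForm (T : Matrix (Fin r) (Fin r) ℂ) : Continuous (hermForm T) := by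
  unfold hermForm
  fun_prop

/-- The density of the law `CN(0, S)`. -/
noncomputable def gaussDensity (S : Matrix (Fin r) (Fin r) ℂ) (y : Fin r → ℂ) : ℝ :=
  (Real.pi ^ r * S.det.re)⁻¹ * Real.exp (-hermForm S⁻¹ y)

lemma gaussDensity_one (y : Fin r → ℂ) :
    gaussDensity 1 y = ∏ i, complexGaussianPDF (y i) := by
  simp [gaussDensity, complexGaussianPDF, hermForm_one, Finset.prod_mul_distrib, ← Real.exp_sum]

lemma noiseLaw_eq_withDensity :
    noiseLaw r = (volume : Measure (Fin r → ℂ)).withDensity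
      fun y => ENNReal.ofReal (gaussDensity 1 y) := by
  simp only [noiseLaw, gaussDensity_one, complexGaussian_eq_withDensity]
  exact pi_withDensity_ofReal integrable_complexGaussianPDF complexGaussianPDF_nonneg

lemma continuous_gaussDensity (S : Matrix (Fin r) (Fin r) ℂ) : Continuous (gaussDensity S) := by
  unfold gaussDensity
  have := continuous_hermForm S⁻¹
  fun_prop

lemma gaussDensity_pos {S : Matrix (Fin r) (Fin r) ℂ} (hS : S.PosDef) (y : Fin r → ℂ) :
    0 < gaussDensity S y := by
  have := re_det_pos hS
  unfold gaussDensity; positivity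

lemma gaussDensity_le {S : Matrix (Fin r) (Fin r) ℂ} (hS : S.PosDef) (y : Fin r → ℂ) :
    gaussDensity S y ≤ (Real.pi ^ r * S.det.re)⁻¹ := by
  have := re_det_pos hS
  refine mul_le_of_le_one_right (by positivity) ?_
  rw [Real.exp_le_one_iff, neg_nonpos]
  exact hS.inv.posSemidef.re_dotProduct_nonneg y

lemma log_gaussDensity {S : Matrix (Fin r) (Fin r) ℂ} (hS : S.PosDef) (y : Fin r → ℂ) :
    Real.log (gaussDensity S y) =
      -Real.log (Real.pi ^ r) - Real.log S.det.re - hermForm S⁻¹ y := by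
  have h := re_det_pos hS
  have hp : (0 : ℝ) < Real.pi ^ r := by positivity
  rw [gaussDensity, Real.log_mul (by positivity) (Real.exp_pos _).ne', Real.log_inv,
    Real.log_mul hp.ne' h.ne', Real.log_exp]
  ring

lemma hermForm_inv_mul_conjTranspose (F : Matrix (Fin r) (Fin r) ℂ) (y : Fin r → ℂ) :
    hermForm (F * Fᴴ)⁻¹ y = hermForm 1 (F⁻¹ *ᵥ y) := by
  rw [hermForm, hermForm, Matrix.mul_inv_rev, one_mulVec, ← mulVec_mulVec,
    ← conjTranspose_nonsing_inv, dotProduct_mulVec, vecMul_conjTranspose, star_star]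

lemma lintegral_gaussDensity_one :
    ∫⁻ y : Fin r → ℂ, ENNReal.ofReal (gaussDensity 1 y) = 1 := by
  have h := measure_univ (μ := noiseLaw r)
  rwa [noiseLaw_eq_withDensity, withDensity_apply _ MeasurableSet.univ, setLIntegral_univ] at h

/-- Writing `S = F F†`, the substitution `y ↦ F⁻¹ y` reduces to the standard density. -/
lemma lintegral_gaussDensity {S : Matrix (Fin r) (Fin r) ℂ} (hS : S.PosDef) :
    ∫⁻ y : Fin r → ℂ, ENNReal.ofReal (gaussDensity S y) = 1 := by
  obtain ⟨F, rfl⟩ := exists_eq_mul_conjTranspose hS.posSemidef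
  set d : ℝ := Complex.normSq F.det with hd
  have hdet : (F * Fᴴ).det = (d : ℂ) := by
    rw [det_mul, det_conjTranspose, Complex.star_def, Complex.mul_conj]
  have hd0 : 0 < d := by simpa [hdet] using re_det_pos hS
  let T : (Fin r → ℂ) →ₗ[ℝ] (Fin r → ℂ) := (Matrix.toLin' F⁻¹).restrictScalars ℝ
  -- The real determinant of a complex-linear map is the squared modulus of its complex determinant,
  -- here `|det F|⁻² = (det S)⁻¹`.
  have hT : LinearMap.det T = d⁻¹ := by
    rw [LinearMap.det_restrictScalars, LinearMap.det_toLin', Algebra.norm_complex_apply,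
      det_nonsing_inv, Ring.inverse_eq_inv', map_inv₀]
  have hTm : Measurable T := T.continuous_of_finiteDimensional.measurable
  have hT0 : LinearMap.det T ≠ 0 := by rw [hT]; exact (inv_pos.2 hd0).ne'
  have hy : ∀ y, gaussDensity (F * Fᴴ) y = d⁻¹ * gaussDensity 1 (T y) := by
    intro y
    have : T y = F⁻¹ *ᵥ y := rfl
    rw [gaussDensity, gaussDensity, hermForm_inv_mul_conjTranspose, hdet, this]
    simp only [Complex.ofReal_re, inv_one, det_one, Complex.one_re, mul_inv]
    ring
  have hm : Measurable fun y : Fin r → ℂ => ENNReal.ofReal (gaussDensity 1 y) :=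
    (continuous_gaussDensity 1).measurable.ennreal_ofReal
  have hmT : Measurable fun y : Fin r → ℂ => ENNReal.ofReal (gaussDensity 1 (T y)) := hm.comp hTm
  simp only [hy, ENNReal.ofReal_mul (inv_pos.2 hd0).le]
  rw [lintegral_const_mul _ hmT, ← lintegral_map hm hTm,
    Measure.map_linearMap_addHaar_eq_smul_addHaar _ hT0, lintegral_smul_measure,
    lintegral_gaussDensity_one, hT, inv_inv, abs_of_pos hd0, smul_eq_mul, mul_one,
    ← ENNReal.ofReal_mul (inv_pos.2 hd0).le, inv_mul_cancel₀ hd0.ne', ENNReal.ofReal_one]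

end GaussianDensity


/-! ### Expected Hermitian forms of uncorrelated variables -/

section SecondMoments

lemma integral_comp_of_measurePreserving {α β E : Type*} [MeasurableSpace α] [MeasurableSpace β]
    [NormedAddCommGroup E] [NormedSpace ℝ E] {μ : Measure α} {ν : Measure β} {g : α → β}
    (hg : MeasurePreserving g μ ν) {f : β → E} (hf : AEStronglyMeasurable f ν) :
    ∫ x, f (g x) ∂μ = ∫ y, f y ∂ν := by
  rw [← hg.map_eq] at hf ⊢
  exact (integral_map hg.measurable.aemeasurable hf).symm

lemma integral_pi_mul_of_ne {ι : Type*} [Fintype ι] {Ω : ι → Type*}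
    [∀ i, MeasurableSpace (Ω i)] (μ : (i : ι) → Measure (Ω i)) [∀ i, IsProbabilityMeasure (μ i)]
    {i j : ι} (hij : i ≠ j) {f : Ω i → ℂ} {g : Ω j → ℂ} (hf : Measurable f) (hg : Measurable g) :
    ∫ x, f (x i) * g (x j) ∂(Measure.pi μ) = (∫ x, f x ∂(μ i)) * ∫ x, g x ∂(μ j) := by
  have hind := (iIndepFun_pi (μ := μ) (X := fun _ x => x)
    fun _ => measurable_id.aemeasurable).indepFun hij
  have h := (hind.comp hf hg).integral_fun_mul_eq_mul_integral
    (hf.comp (measurable_pi_apply i)).aestronglyMeasurable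
    (hg.comp (measurable_pi_apply j)).aestronglyMeasurable
  refine h.trans ?_
  congr 1
  · exact integral_comp_of_measurePreserving (measurePreserving_eval μ i) hf.aestronglyMeasurable
  · exact integral_comp_of_measurePreserving (measurePreserving_eval μ j) hg.aestronglyMeasurable

variable {Ω κ : Type*} [MeasurableSpace Ω] {ρ : Measure Ω} [Fintype κ] {r : ℕ}

lemma hermForm_mulVec (T : Matrix (Fin r) (Fin r) ℂ) (a : Matrix (Fin r) κ ℂ) (z : κ → ℂ) :
    hermForm T (a *ᵥ z) = ∑ k, ∑ l, ((aᴴ * T * a) k l * (star (z k) * z l)).re := by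
  have : star (a *ᵥ z) ⬝ᵥ (T *ᵥ (a *ᵥ z)) = star z ⬝ᵥ ((aᴴ * T * a) *ᵥ z) := by
    rw [star_mulVec, ← dotProduct_mulVec, mulVec_mulVec, mulVec_mulVec]
  rw [hermForm, this]
  simp only [dotProduct, mulVec, Finset.mul_sum, Complex.re_sum, Pi.star_apply]
  refine Finset.sum_congr rfl fun k _ => Finset.sum_congr rfl fun l _ => ?_
  congr 1; ring

lemma integrable_star_mul {f g : Ω → ℂ} (hf : MemLp f 2 ρ) (hg : MemLp g 2 ρ) :
    Integrable (fun ω => star (f ω) * g ω) ρ :=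
  MemLp.integrable_mul hf.star hg

lemma integrable_hermForm (T : Matrix (Fin r) (Fin r) ℂ) (a : Matrix (Fin r) κ ℂ)
    {ξ : κ → Ω → ℂ} (hξ : ∀ k, MemLp (ξ k) 2 ρ) :
    Integrable (fun ω => hermForm T (a *ᵥ fun k => ξ k ω)) ρ := by
  simp only [hermForm_mulVec]
  exact integrable_finsetSum _ fun k _ => integrable_finsetSum _ fun l _ =>
    ((integrable_star_mul (hξ k) (hξ l)).const_mul _).re

open scoped ComplexOrder MatrixOrder in
-- Orthogonality kills the off-diagonal terms of `G = a† T a`. Its diagonal is nonnegative, so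
-- variances at most 1 suffice, and cyclicity of the trace gives the stated form.
lemma integral_hermForm_le {T : Matrix (Fin r) (Fin r) ℂ} (hT : T.PosSemidef)
    (a : Matrix (Fin r) κ ℂ) {ξ : κ → Ω → ℂ} (hξ : ∀ k, MemLp (ξ k) 2 ρ)
    (horth : ∀ k l, k ≠ l → ∫ ω, star (ξ k ω) * ξ l ω ∂ρ = 0)
    (hvar : ∀ k, ∫ ω, ‖ξ k ω‖ ^ 2 ∂ρ ≤ 1) :
    ∫ ω, hermForm T (a *ᵥ fun k => ξ k ω) ∂ρ ≤ (T * (a * aᴴ)).trace.re := by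
  classical
  set G := aᴴ * T * a with hG
  have hGp : G.PosSemidef := hT.conjTranspose_mul_mul_same a
  have hint : ∀ k l, Integrable (fun ω => G k l * (star (ξ k ω) * ξ l ω)) ρ := fun k l =>
    (integrable_star_mul (hξ k) (hξ l)).const_mul _
  have hterm : ∀ k l, ∫ ω, (G k l * (star (ξ k ω) * ξ l ω)).re ∂ρ =
      if k = l then (G k k).re * ∫ ω, ‖ξ k ω‖ ^ 2 ∂ρ else 0 := by
    intro k l
    split_ifs with hkl
    · subst hkl
      rw [← integral_const_mul]
      refine integral_congr_ae (Filter.Eventually.of_forall fun ω => ?_)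
      simp only [Complex.star_def, Complex.conj_mul']
      rw [← Complex.ofReal_pow, Complex.re_mul_ofReal]
    · have h := integral_re (hint k l)
      simp only [RCLike.re_to_complex] at h
      rw [h, integral_const_mul, horth k l hkl, mul_zero, Complex.zero_re]
  have hint' : ∀ k l, Integrable (fun ω => (G k l * (star (ξ k ω) * ξ l ω)).re) ρ := fun k l =>
    (hint k l).re
  simp only [hermForm_mulVec, ← hG]
  rw [integral_finsetSum _ fun k _ => integrable_finsetSum _ fun l _ => hint' k l]
  have htr : (T * (a * aᴴ)).trace = G.trace := by
    rw [← Matrix.mul_assoc, trace_mul_comm, ← Matrix.mul_assoc]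
  rw [htr, trace, Complex.re_sum]
  refine Finset.sum_le_sum fun k _ => ?_
  rw [integral_finsetSum _ fun l _ => hint' k l]
  simp only [hterm, Finset.sum_ite_eq, Finset.mem_univ, if_true, diag_apply]
  exact mul_le_of_le_one_right (Complex.le_def.1 (hGp.diag_nonneg (i := k))).1 (hvar k)

end SecondMoments

/-! ### Moments of the uniform and Gaussian marginals -/

section Marginals

/-- Constellations need not have mean zero; centring only lowers the energy, by `‖m‖²`. -/
lemma integral_norm_sub_integral_sq_le {ν : Measure ℂ} [IsProbabilityMeasure ν]
    (h : MemLp (fun z => z) 2 ν) :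
    ∫ z, ‖z - ∫ w, w ∂ν‖ ^ 2 ∂ν ≤ ∫ z, ‖z‖ ^ 2 ∂ν := by
  set m := ∫ w, w ∂ν with hm
  have hi : Integrable (fun z : ℂ => z) ν := h.integrable (by norm_num)
  have hsq : Integrable (fun z : ℂ => ‖z‖ ^ 2) ν := h.integrable_norm_pow (p := 2) (by norm_num)
  have hc : Integrable (fun z : ℂ => star m * z) ν := hi.const_mul _
  have hcr : Integrable (fun z : ℂ => (star m * z).re) ν := hc.re
  have hpt : ∀ z : ℂ, ‖z - m‖ ^ 2 = ‖z‖ ^ 2 - 2 * (star m * z).re + ‖m‖ ^ 2 := by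
    intro z
    simp only [Complex.sq_norm, Complex.normSq_apply, Complex.sub_re, Complex.sub_im,
      Complex.mul_re, Complex.star_def, Complex.conj_re, Complex.conj_im]
    ring
  have hcv : ∫ z, (star m * z).re ∂ν = ‖m‖ ^ 2 := by
    have h1 := integral_re hc
    simp only [RCLike.re_to_complex] at h1
    rw [h1, integral_const_mul, ← hm, Complex.star_def, Complex.conj_mul']
    norm_cast
  simp only [hpt]
  have h2 : Integrable (fun z : ℂ => ‖z‖ ^ 2 - 2 * (star m * z).re) ν := hsq.sub (hcr.const_mul 2)
  rw [integral_add h2 (integrable_const _), integral_sub hsq (hcr.const_mul 2),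
    integral_const_mul, hcv]
  simp only [integral_const, probReal_univ, one_smul]
  nlinarith [sq_nonneg ‖m‖]

lemma memLp_uniformOn (S : Finset ℂ) (p : ℝ≥0∞) :
    MemLp (fun z => z) p (uniformOn (S : Set ℂ)) := by
  obtain ⟨B, hB⟩ := S.finite_toSet.isBounded.exists_norm_le
  refine MemLp.of_bound measurable_id.aestronglyMeasurable B ?_
  filter_upwards [ae_cond_mem S.measurableSet] with z hz using hB z hz

lemma integral_uniformOn (S : Finset ℂ) (f : ℂ → ℝ) :
    ∫ z, f z ∂(uniformOn (S : Set ℂ)) = (∑ z ∈ S, f z) / (S.card : ℝ) := by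
  have hint : IntegrableOn f (S : Set ℂ) Measure.count := by
    rw [← (S : Set ℂ).biUnion_of_singleton]
    simp [integrableOn_finset_iUnion]
  rw [uniformOn, ProbabilityTheory.cond, integral_smul_measure, setIntegral_finset _ hint]
  simp [div_eq_inv_mul, Measure.real]

lemma measurePreserving_re_im :
    MeasurePreserving (fun z : ℂ => (z.re, z.im)) complexGaussian
      ((gaussianReal 0 (1 / 2)).prod (gaussianReal 0 (1 / 2))) := by
  have h : complexGaussian = ((gaussianReal 0 (1 / 2)).prod (gaussianReal 0 (1 / 2))).map
      Complex.measurableEquivRealProd.symm := rfl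
  rw [h]
  exact ((MeasurableEquiv.measurable Complex.measurableEquivRealProd.symm).measurePreserving _).symm _

lemma memLp_complexGaussian : MemLp (fun z => z) 2 complexGaussian := by
  have hG : MemLp (fun x : ℝ => x) 2 (gaussianReal 0 (1 / 2)) :=
    memLp_id_gaussianReal' 2 (by norm_num)
  have h1 : MemLp (fun z : ℂ => (z.re : ℂ)) 2 complexGaussian :=
    (hG.comp_measurePreserving (measurePreserving_fst.comp measurePreserving_re_im)).ofReal
  have h2 : MemLp (fun z : ℂ => (z.im : ℂ)) 2 complexGaussian :=
    (hG.comp_measurePreserving (measurePreserving_snd.comp measurePreserving_re_im)).ofReal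
  refine (h1.add (h2.const_mul Complex.I)).ae_eq (Filter.Eventually.of_forall fun z => ?_)
  simp [Complex.ext_iff]

lemma integral_complexGaussian : ∫ z, z ∂complexGaussian = 0 := by
  have hi : Integrable (fun z : ℂ => z) complexGaussian :=
    memLp_complexGaussian.integrable (by norm_num)
  have hre := integral_re hi
  have him := integral_im hi
  simp only [RCLike.re_to_complex, RCLike.im_to_complex] at hre him
  have h1 := integral_comp_of_measurePreserving
    (measurePreserving_fst.comp measurePreserving_re_im)
    (f := fun x : ℝ => x) measurable_id.aestronglyMeasurable
  have h2 := integral_comp_of_measurePreserving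
    (measurePreserving_snd.comp measurePreserving_re_im)
    (f := fun x : ℝ => x) measurable_id.aestronglyMeasurable
  simp only [Function.comp_apply, integral_id_gaussianReal] at h1 h2
  exact Complex.ext (hre.symm.trans h1) (him.symm.trans h2)

lemma integral_norm_sq_complexGaussian : ∫ z, ‖z‖ ^ 2 ∂complexGaussian = 1 := by
  have hv : ∫ x, x ^ 2 ∂(gaussianReal 0 (1 / 2)) = 1 / 2 := by
    have h := variance_fun_id_gaussianReal (μ := 0) (v := 1 / 2)
    rw [variance_eq_integral measurable_id'.aemeasurable] at h
    simpa using h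
  have hG : Integrable (fun x : ℝ => x ^ 2) (gaussianReal 0 (1 / 2)) :=
    (memLp_id_gaussianReal' 2 (by norm_num)).integrable_sq
  have hf := measurePreserving_fst.comp measurePreserving_re_im
  have hs := measurePreserving_snd.comp measurePreserving_re_im
  have h1 := integral_comp_of_measurePreserving hf
    (f := fun x : ℝ => x ^ 2) (by fun_prop)
  have h2 := integral_comp_of_measurePreserving hs
    (f := fun x : ℝ => x ^ 2) (by fun_prop)
  have hi1 := hf.integrable_comp_of_integrable hG
  have hi2 := hs.integrable_comp_of_integrable hG
  simp only [Function.comp_def] at h1 h2 hi1 hi2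
  have hpt : ∀ z : ℂ, ‖z‖ ^ 2 = z.re ^ 2 + z.im ^ 2 := fun z => by
    rw [Complex.sq_norm, Complex.normSq_apply]; ring
  simp only [hpt]
  rw [integral_add hi1 hi2, h1, h2, hv]
  norm_num

end Marginals


/-! ### The uplink channel and the bound for a fixed `R` -/

section GaussianChannel

/-- For each fixed `x` this is translation invariance of Lebesgue measure. -/
lemma map_shear_prod_withDensity {𝓧 : Type*} [MeasurableSpace 𝓧] {r : ℕ} (μ : Measure 𝓧)
    [IsProbabilityMeasure μ] {h : 𝓧 → Fin r → ℂ} (hh : Measurable h)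
    {g : (Fin r → ℂ) → ℝ≥0∞} (hg : Measurable g)
    [SFinite ((volume : Measure (Fin r → ℂ)).withDensity g)] :
    (μ.prod ((volume : Measure (Fin r → ℂ)).withDensity g)).map (fun ω => (ω.1, h ω.1 + ω.2)) =
      (μ.prod volume).withDensity fun z => g (z.2 - h z.1) := by
  have hm : Measurable fun ω : 𝓧 × (Fin r → ℂ) => (ω.1, h ω.1 + ω.2) := by fun_prop
  have hgm : Measurable fun z : 𝓧 × (Fin r → ℂ) => g (z.2 - h z.1) := by fun_prop
  have hgs : Measurable fun z : 𝓧 × (Fin r → ℂ) => g z.2 := by fun_prop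
  ext t ht
  rw [Measure.map_apply hm ht, prod_withDensity_right hg, withDensity_apply _ (hm ht),
    withDensity_apply _ ht, ← lintegral_indicator (hm ht), ← lintegral_indicator ht,
    lintegral_prod _ (hgs.indicator (hm ht)).aemeasurable,
    lintegral_prod _ (hgm.indicator ht).aemeasurable]
  refine lintegral_congr fun x => ?_
  conv_rhs => rw [← lintegral_add_left_eq_self _ (h x)]
  refine lintegral_congr fun v => ?_
  simp only [Set.indicator, add_sub_cancel_left]
  rfl

variable {K N Nr Nt : ℕ} (s : System K N Nr Nt)

/-- The amplitude `√p_e c_e(n)`. -/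
noncomputable def System.gain (n : Fin N) (e : s.Element) : ℂ :=
  ((Real.sqrt (s.psd e) * s.alloc e n : ℝ) : ℂ)

/-- The noiseless channel output. -/
noncomputable def System.signal (n : Fin N) (A : Finset s.Element) (x : (e : A) → Fin Nt → ℂ) :
    Fin Nr → ℂ :=
  ∑ e : A, s.gain n e.1 • (s.effChannel n e.1 *ᵥ x e)

lemma System.continuous_signal (n : Fin N) (A : Finset s.Element) :
    Continuous (s.signal n A) := by
  unfold System.signal; fun_prop

/-- Idempotence of `c_e(n)` is what matches the squared amplitude `√p_e c_e(n)` with the coefficient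
`p_e c_e(n)` in the covariance. -/
lemma System.alloc_mul_self (e : s.Element) (n : Fin N) :
    s.alloc e n * s.alloc e n = s.alloc e n := by
  have h : ∀ c : Fin 2, (((c : ℕ) : ℝ) * ((c : ℕ) : ℝ)) = ((c : ℕ) : ℝ) := by
    intro c; fin_cases c <;> simp
  exact h _

lemma System.gain_mul_star (hb : ∀ k, 0 ≤ s.budget k) (n : Fin N) (e : s.Element) :
    s.gain n e * star (s.gain n e) = ((s.psd e * s.alloc e n : ℝ) : ℂ) := by
  rw [System.gain, Complex.star_def, Complex.conj_ofReal, ← Complex.ofReal_mul]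
  congr 1
  rw [mul_mul_mul_comm, Real.mul_self_sqrt (s.psd_nonneg hb e), s.alloc_mul_self]

lemma System.constellation_nonempty (hu : s.UnitEnergy) (e : s.Element) :
    (s.constellation e).Nonempty := by
  rw [Finset.nonempty_iff_ne_empty]
  intro h
  have := hu e
  -- An empty constellation would have average energy `0 / 0 = 0`.
  simp [h] at this

lemma System.isProbabilityMeasure_uniformOn (hu : s.UnitEnergy) (e : s.Element) :
    IsProbabilityMeasure (uniformOn (s.constellation e : Set ℂ)) :=
  ProbabilityTheory.isProbabilityMeasure_uniformOn (Finset.finite_toSet _)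
    (s.constellation_nonempty hu e)

lemma System.isProbabilityMeasure_inputLaw (hu : s.UnitEnergy) (A : Finset s.Element) :
    IsProbabilityMeasure (s.inputLaw A) := by
  have := s.isProbabilityMeasure_uniformOn hu
  unfold System.inputLaw; infer_instance

/-- The scalar input symbols and noise components. -/
def System.coord (A : Finset s.Element) :
    (A × Fin Nt) ⊕ Fin Nr → ((e : A) → Fin Nt → ℂ) × (Fin Nr → ℂ) → ℂ
  | Sum.inl k, ω => ω.1 k.1 k.2
  | Sum.inr i, ω => ω.2 i

/-- The laws of the scalar input symbols and noise components. -/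
noncomputable def System.coordLaw (A : Finset s.Element) :
    (A × Fin Nt) ⊕ Fin Nr → Measure ℂ
  | Sum.inl k => uniformOn (s.constellation k.1.1 : Set ℂ)
  | Sum.inr _ => complexGaussian

lemma System.measurePreserving_coord (hu : s.UnitEnergy) (A : Finset s.Element)
    (k : (A × Fin Nt) ⊕ Fin Nr) :
    MeasurePreserving (s.coord A k) ((s.inputLaw A).prod (noiseLaw Nr)) (s.coordLaw A k) := by
  have := s.isProbabilityMeasure_uniformOn hu
  have := s.isProbabilityMeasure_inputLaw hu A
  rcases k with ⟨e, t⟩ | i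
  · have h1 := measurePreserving_eval (fun e : A => Measure.pi fun _ : Fin Nt =>
      uniformOn (s.constellation e.1 : Set ℂ)) e
    have h2 := measurePreserving_eval (fun _ : Fin Nt =>
      uniformOn (s.constellation e.1 : Set ℂ)) t
    exact (h2.comp h1).comp (measurePreserving_fst (ν := noiseLaw Nr))
  · exact (measurePreserving_eval (fun _ : Fin Nr => complexGaussian) i).comp
      measurePreserving_snd

lemma System.isProbabilityMeasure_coordLaw (hu : s.UnitEnergy) (A : Finset s.Element)
    (k : (A × Fin Nt) ⊕ Fin Nr) : IsProbabilityMeasure (s.coordLaw A k) := by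
  have := s.isProbabilityMeasure_uniformOn hu
  rcases k with k | i <;> simp only [System.coordLaw] <;> infer_instance

/-- Independence is read off the nested product measure, according to where the two coordinates
separate: within one symbol vector, between elements, between input and noise, or within the noise.
-/
lemma System.integral_coord_mul (hu : s.UnitEnergy) (A : Finset s.Element)
    {k l : (A × Fin Nt) ⊕ Fin Nr} (hkl : k ≠ l) {f g : ℂ → ℂ} (hf : Measurable f)
    (hg : Measurable g) :
    ∫ ω, f (s.coord A k ω) * g (s.coord A l ω) ∂((s.inputLaw A).prod (noiseLaw Nr)) =
      (∫ z, f z ∂(s.coordLaw A k)) * ∫ z, g z ∂(s.coordLaw A l) := by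
  have := s.isProbabilityMeasure_uniformOn hu
  have := s.isProbabilityMeasure_inputLaw hu A
  have hfst := measurePreserving_fst (μ := s.inputLaw A) (ν := noiseLaw Nr)
  have hsnd := measurePreserving_snd (μ := s.inputLaw A) (ν := noiseLaw Nr)
  have hin : ∀ (e : A) (t : Fin Nt) {u : ℂ → ℂ}, Measurable u →
      ∫ x, u (x e t) ∂(s.inputLaw A) = ∫ z, u z ∂(uniformOn (s.constellation e.1 : Set ℂ)) := by
    intro e t u hum
    have h1 := measurePreserving_eval (fun e : A => Measure.pi fun _ : Fin Nt =>
      uniformOn (s.constellation e.1 : Set ℂ)) e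
    have h2 := measurePreserving_eval (fun _ : Fin Nt =>
      uniformOn (s.constellation e.1 : Set ℂ)) t
    exact integral_comp_of_measurePreserving (h2.comp h1) hum.aestronglyMeasurable
  have hno : ∀ (i : Fin Nr) {u : ℂ → ℂ}, Measurable u →
      ∫ v, u (v i) ∂(noiseLaw Nr) = ∫ z, u z ∂complexGaussian := fun i u hum =>
    integral_comp_of_measurePreserving
      (measurePreserving_eval (fun _ : Fin Nr => complexGaussian) i) hum.aestronglyMeasurable
  rcases k with ⟨e, t⟩ | i <;> rcases l with ⟨e', t'⟩ | j <;> simp only [coord, coordLaw]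
  · have hm : Measurable fun x : (e : A) → Fin Nt → ℂ => f (x e t) * g (x e' t') := by fun_prop
    rw [integral_comp_of_measurePreserving hfst
      (f := fun x => f (x e t) * g (x e' t')) hm.aestronglyMeasurable]
    by_cases he : e = e'
    · subst he
      have ht : t ≠ t' := fun h => hkl (by rw [h])
      have hm' : Measurable fun x : Fin Nt → ℂ => f (x t) * g (x t') := by fun_prop
      have h1 := measurePreserving_eval (fun e : A => Measure.pi fun _ : Fin Nt =>
        uniformOn (s.constellation e.1 : Set ℂ)) e
      exact (integral_comp_of_measurePreserving h1 hm'.aestronglyMeasurable).trans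
        (integral_pi_mul_of_ne _ ht hf hg)
    · have h := integral_pi_mul_of_ne (fun e : A => Measure.pi fun _ : Fin Nt =>
        uniformOn (s.constellation e.1 : Set ℂ)) he (f := fun x => f (x t))
        (g := fun x => g (x t')) (by fun_prop) (by fun_prop)
      refine h.trans ?_
      congr 1
      · exact integral_comp_of_measurePreserving
          (measurePreserving_eval (fun _ : Fin Nt => _) t) hf.aestronglyMeasurable
      · exact integral_comp_of_measurePreserving
          (measurePreserving_eval (fun _ : Fin Nt => _) t') hg.aestronglyMeasurable
  · rw [integral_prod_mul (fun x : (e : A) → Fin Nt → ℂ => f (x e t))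
      (fun v : Fin Nr → ℂ => g (v j)), hin e t hf, hno j hg]
  · simp only [mul_comm (f _)]
    rw [integral_prod_mul (fun x : (e : A) → Fin Nt → ℂ => g (x e' t'))
      (fun v : Fin Nr → ℂ => f (v i)), hin e' t' hg, hno i hf, mul_comm]
  · have hij : i ≠ j := fun h => hkl (by rw [h])
    have hm : Measurable fun v : Fin Nr → ℂ => f (v i) * g (v j) := by fun_prop
    rw [integral_comp_of_measurePreserving hsnd
      (f := fun v => f (v i) * g (v j)) hm.aestronglyMeasurable]
    exact integral_pi_mul_of_ne _ hij hf hg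

lemma System.memLp_coordLaw (A : Finset s.Element) (k : (A × Fin Nt) ⊕ Fin Nr) :
    MemLp (fun z => z) 2 (s.coordLaw A k) := by
  rcases k with k | i
  · exact memLp_uniformOn _ _
  · exact memLp_complexGaussian

lemma System.integral_norm_sq_coordLaw (hu : s.UnitEnergy) (A : Finset s.Element)
    (k : (A × Fin Nt) ⊕ Fin Nr) : ∫ z, ‖z‖ ^ 2 ∂(s.coordLaw A k) = 1 := by
  rcases k with k | i
  · exact (integral_uniformOn _ _).trans (hu k.1.1)
  · exact integral_norm_sq_complexGaussian

/-- The centred scalar input symbols and noise components. -/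
noncomputable def System.centred (A : Finset s.Element) (k : (A × Fin Nt) ⊕ Fin Nr)
    (ω : ((e : A) → Fin Nt → ℂ) × (Fin Nr → ℂ)) : ℂ :=
  s.coord A k ω - ∫ z, z ∂(s.coordLaw A k)

lemma System.memLp_centred (hu : s.UnitEnergy) (A : Finset s.Element)
    (k : (A × Fin Nt) ⊕ Fin Nr) :
    MemLp (s.centred A k) 2 ((s.inputLaw A).prod (noiseLaw Nr)) := by
  have := s.isProbabilityMeasure_inputLaw hu A
  exact ((s.memLp_coordLaw A k).comp_measurePreserving (s.measurePreserving_coord hu A k)).sub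
    (memLp_const _)

lemma System.integral_centred_orthogonal (hu : s.UnitEnergy) (A : Finset s.Element)
    {k l : (A × Fin Nt) ⊕ Fin Nr} (hkl : k ≠ l) :
    ∫ ω, star (s.centred A k ω) * s.centred A l ω ∂((s.inputLaw A).prod (noiseLaw Nr)) = 0 := by
  have := s.isProbabilityMeasure_coordLaw hu A l
  refine (s.integral_coord_mul hu A hkl (f := fun z => star (z - ∫ w, w ∂(s.coordLaw A k)))
    (g := fun z => z - ∫ w, w ∂(s.coordLaw A l)) (by fun_prop) (by fun_prop)).trans ?_
  have hi : Integrable (fun z : ℂ => z) (s.coordLaw A l) :=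
    (s.memLp_coordLaw A l).integrable (by norm_num)
  rw [integral_sub hi (integrable_const _)]
  simp

lemma System.integral_norm_centred_sq_le (hu : s.UnitEnergy) (A : Finset s.Element)
    (k : (A × Fin Nt) ⊕ Fin Nr) :
    ∫ ω, ‖s.centred A k ω‖ ^ 2 ∂((s.inputLaw A).prod (noiseLaw Nr)) ≤ 1 := by
  have := s.isProbabilityMeasure_coordLaw hu A k
  rw [← s.integral_norm_sq_coordLaw hu A k]
  refine le_of_eq_of_le ?_ (integral_norm_sub_integral_sq_le (s.memLp_coordLaw A k))
  exact integral_comp_of_measurePreserving (s.measurePreserving_coord hu A k)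
    (f := fun z => ‖z - ∫ w, w ∂(s.coordLaw A k)‖ ^ 2)
    (Measurable.aestronglyMeasurable (by fun_prop))

open Classical in
/-- The input with the symbols outside `R` replaced by their means. -/
noncomputable def System.partialMean (A R : Finset s.Element) (x : (e : A) → Fin Nt → ℂ)
    (e : A) : Fin Nt → ℂ :=
  if e.1 ∈ R then x e else fun _ => ∫ z, z ∂(uniformOn (s.constellation e.1 : Set ℂ))

open Classical in
/-- The matrix mapping the symbols outside `R` to the channel output. -/
noncomputable def System.mixing (n : Fin N) (A R : Finset s.Element) :
    Matrix (Fin Nr) (A × Fin Nt) ℂ :=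
  Matrix.of fun i k => if k.1.1 ∈ R then 0 else s.gain n k.1.1 * s.effChannel n k.1.1 i k.2

/-- Symbols in `R` cancel, matching the zero columns of `mixing`; the noise has mean zero and so is
its own centred version. -/
lemma System.signal_sub_signal_partialMean (n : Fin N) (A R : Finset s.Element)
    (x : (e : A) → Fin Nt → ℂ) (v : Fin Nr → ℂ) :
    s.signal n A x + v - s.signal n A (s.partialMean A R x) =
      fromCols (s.mixing n A R) (1 : Matrix (Fin Nr) (Fin Nr) ℂ) *ᵥ
        fun k => s.centred A k (x, v) := by
  have hr : (fun i : Fin Nr => s.centred A (Sum.inr i) (x, v)) = v := by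
    ext i
    simp [System.centred, System.coord, System.coordLaw, integral_complexGaussian]
  have hl : s.signal n A x - s.signal n A (s.partialMean A R x) =
      s.mixing n A R *ᵥ fun k => s.centred A (Sum.inl k) (x, v) := by
    ext i
    simp only [System.signal, ← Finset.sum_sub_distrib, ← smul_sub, ← mulVec_sub]
    simp only [Finset.sum_apply, Pi.smul_apply, mulVec, dotProduct, Fintype.sum_prod_type,
      smul_eq_mul, Finset.mul_sum]
    refine Finset.sum_congr rfl fun e _ => Finset.sum_congr rfl fun t _ => ?_
    by_cases he : e.1 ∈ R
    · simp [System.mixing, System.partialMean, he]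
    · simp [System.mixing, System.partialMean, he, System.centred, System.coord,
        System.coordLaw, mul_assoc]
  rw [add_sub_right_comm, hl, fromCols_mulVec]
  congr 1
  rw [one_mulVec]
  exact hr.symm

open Classical in
lemma System.mixing_mul_conjTranspose (hb : ∀ k, 0 ≤ s.budget k) (n : Fin N)
    (A R : Finset s.Element) :
    s.mixing n A R * (s.mixing n A R)ᴴ = s.signalCov n (A \ R) := by
  ext i j
  have hsd : A \ R = A.filter fun e => e ∉ R := by ext e; simp
  rw [System.signalCov, hsd, Finset.sum_filter, ← Finset.sum_coe_sort A]
  simp only [mul_apply, Matrix.sum_apply, Fintype.sum_prod_type]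
  refine Finset.sum_congr rfl fun e _ => ?_
  by_cases he : e.1 ∈ R
  · simp [System.mixing, he]
  · simp only [System.mixing, he, not_false_eq_true, if_true, if_false, Matrix.smul_apply, mul_apply,
      conjTranspose_apply, of_apply, smul_eq_mul, Finset.mul_sum, ← s.gain_mul_star hb, star_mul]
    refine Finset.sum_congr rfl fun t _ => ?_
    ring

open Classical in
lemma System.fromCols_mul_conjTranspose (hb : ∀ k, 0 ≤ s.budget k) (n : Fin N)
    (A R : Finset s.Element) :
    fromCols (s.mixing n A R) (1 : Matrix (Fin Nr) (Fin Nr) ℂ) *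
      (fromCols (s.mixing n A R) (1 : Matrix (Fin Nr) (Fin Nr) ℂ))ᴴ =
      1 + s.signalCov n (A \ R) := by
  rw [conjTranspose_fromCols_eq_fromRows_conjTranspose, fromCols_mul_fromRows,
    s.mixing_mul_conjTranspose hb, conjTranspose_one, one_mul, add_comm]

open Classical in
/-- A function of the symbols in `R` is bounded by the number of their values times its mean. -/
lemma System.ae_le_card_mul_integral (hu : s.UnitEnergy) (A R : Finset s.Element) :
    ∀ᵐ x ∂(s.inputLaw A), ∀ φ : ((e : A) → Fin Nt → ℂ) → ℝ, (∀ x, 0 ≤ φ x) →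
      Integrable φ (s.inputLaw A) →
      (∀ x x', (∀ e : A, e.1 ∈ R → x e = x' e) → φ x = φ x') →
      φ x ≤ (∏ e : A, if e.1 ∈ R then ((s.constellation e.1).card : ℝ) ^ Nt else 1) *
        ∫ x', φ x' ∂(s.inputLaw A) := by
  have := s.isProbabilityMeasure_uniformOn hu
  have := s.isProbabilityMeasure_inputLaw hu A
  have hsupp : ∀ᵐ x ∂(s.inputLaw A), ∀ (e : A) (t : Fin Nt), x e t ∈ s.constellation e.1 := by
    rw [ae_all_iff]; intro e
    rw [ae_all_iff]; intro t
    have h1 := measurePreserving_eval (fun e : A => Measure.pi fun _ : Fin Nt =>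
      uniformOn (s.constellation e.1 : Set ℂ)) e
    have h2 := measurePreserving_eval (fun _ : Fin Nt =>
      uniformOn (s.constellation e.1 : Set ℂ)) t
    have h3 : ∀ᵐ z ∂(uniformOn (s.constellation e.1 : Set ℂ)), z ∈ s.constellation e.1 :=
      ae_cond_mem (s.constellation e.1).measurableSet
    exact (h2.comp h1).quasiMeasurePreserving.ae h3
  filter_upwards [hsupp] with x hx φ hφ0 hφi hφ
  -- The cylinder of inputs agreeing with `x` on `R`: it has probability `M⁻¹` and `φ` is constant
  -- on it, so `M⁻¹ * φ x` is part of the integral of `φ ≥ 0`.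
  set B : Set ((e : A) → Fin Nt → ℂ) :=
    Set.univ.pi fun e => if e.1 ∈ R then {x e} else Set.univ with hB
  have hBm : MeasurableSet B := MeasurableSet.univ_pi fun e => by
    split_ifs <;> measurability
  have hone : ∀ (e : A) (t : Fin Nt), uniformOn (s.constellation e.1 : Set ℂ) {x e t} =
      ((s.constellation e.1).card : ℝ≥0∞)⁻¹ := by
    intro e t
    have h := uniformOn_apply_finset (s := s.constellation e.1) (t := {x e t})
    rw [Finset.inter_singleton_of_mem (hx e t)] at h
    simpa using h
  have hμB : s.inputLaw A B =
      ∏ e : A, if e.1 ∈ R then (((s.constellation e.1).card : ℝ≥0∞)⁻¹) ^ Nt else 1 := by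
    rw [hB, System.inputLaw, Measure.pi_pi]
    refine Finset.prod_congr rfl fun e _ => ?_
    split_ifs with he
    · rw [← Set.univ_pi_singleton, Measure.pi_pi]
      simp [hone]
    · exact measure_univ
  set M : ℝ := ∏ e : A, if e.1 ∈ R then ((s.constellation e.1).card : ℝ) ^ Nt else 1 with hM
  have hcard : ∀ e : A, (0 : ℝ) < (s.constellation e.1).card := fun e => by
    exact_mod_cast (s.constellation_nonempty hu e.1).card_pos
  have hM0 : 0 < M := Finset.prod_pos fun e _ => by
    split_ifs
    · exact pow_pos (hcard e) _
    · exact one_pos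
  have hμBr : (s.inputLaw A).real B = M⁻¹ := by
    rw [Measure.real, hμB, ENNReal.toReal_prod, hM, ← Finset.prod_inv_distrib]
    refine Finset.prod_congr rfl fun e _ => ?_
    split_ifs <;> simp
  have hconst : ∫ x' in B, φ x' ∂(s.inputLaw A) = M⁻¹ * φ x := by
    rw [setIntegral_congr_fun hBm (g := fun _ => φ x), setIntegral_const, hμBr, smul_eq_mul]
    intro x' hx'
    refine hφ _ _ fun e he => ?_
    have := hx' e (Set.mem_univ e)
    simpa [he] using this
  have hle : M⁻¹ * φ x ≤ ∫ x', φ x' ∂(s.inputLaw A) := by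
    rw [← hconst]
    exact setIntegral_le_integral hφi (Filter.Eventually.of_forall hφ0)
  rw [← div_le_iff₀' hM0, div_eq_inv_mul]
  exact hle

open scoped ComplexOrder MatrixOrder

open Classical in
-- The auxiliary channel reveals the symbols in `R`, at cost `log M`, and treats the remaining ones
-- together with the noise as a Gaussian of covariance `S`.
theorem System.info_le (hb : ∀ k, 0 ≤ s.budget k) (hu : s.UnitEnergy) (n : Fin N)
    (A R : Finset s.Element) (hR : R ⊆ A) :
    s.info n A ≤ ENNReal.ofReal
      (s.logDet n (A \ R) + ∑ e ∈ R, (Nt : ℝ) * Real.log ((s.constellation e).card : ℝ)) := by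
  have := s.isProbabilityMeasure_inputLaw hu A
  set μ := s.inputLaw A with hμ
  set ρ := μ.prod (noiseLaw Nr) with hρ
  set S : Matrix (Fin Nr) (Fin Nr) ℂ := 1 + s.signalCov n (A \ R) with hS
  have hSp : S.PosDef := s.one_add_signalCov_posDef hb n _
  have h1p : (1 : Matrix (Fin Nr) (Fin Nr) ℂ).PosDef := PosDef.one
  set M : ℝ := ∏ e : A, if e.1 ∈ R then ((s.constellation e.1).card : ℝ) ^ Nt else 1 with hM
  have hcard : ∀ e : s.Element, (0 : ℝ) < (s.constellation e).card := fun e => by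
    exact_mod_cast (s.constellation_nonempty hu e).card_pos
  have hfac : ∀ e : A,
      (0 : ℝ) < if e.1 ∈ R then ((s.constellation e.1).card : ℝ) ^ Nt else 1 := fun e => by
    split_ifs
    · exact pow_pos (hcard e) _
    · exact one_pos
  have hM0 : 0 < M := Finset.prod_pos fun e _ => hfac e
  have hlogM : Real.log M = ∑ e ∈ R, (Nt : ℝ) * Real.log ((s.constellation e).card : ℝ) := by
    rw [hM, Real.log_prod fun e _ => (hfac e).ne', ← Finset.inter_eq_right.2 hR,
      ← Finset.filter_mem_eq_inter, Finset.sum_filter, ← Finset.sum_coe_sort A]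
    refine Finset.sum_congr rfl fun e _ => ?_
    have : (e.1 ∈ A.filter fun i => i ∈ R) ↔ e.1 ∈ R := by simp
    split_ifs <;> simp_all
  have hsig := (s.continuous_signal n A).measurable
  have hpm : Measurable fun x => s.signal n A (s.partialMean A R x) := by
    refine hsig.comp (measurable_pi_lambda _ fun e => ?_)
    unfold System.partialMean
    split_ifs
    · exact measurable_pi_apply e
    · exact measurable_const
  let f : ((e : A) → Fin Nt → ℂ) → (Fin Nr → ℂ) → ℝ := fun x y =>
    gaussDensity 1 (y - s.signal n A x)
  let q : ((e : A) → Fin Nt → ℂ) → (Fin Nr → ℂ) → ℝ := fun x y =>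
    gaussDensity S (y - s.signal n A (s.partialMean A R x))
  have hf : Measurable (Function.uncurry f) :=
    (continuous_gaussDensity 1).measurable.comp
      (measurable_snd.sub (hsig.comp measurable_fst))
  have hq : Measurable (Function.uncurry q) :=
    (continuous_gaussDensity S).measurable.comp
      (measurable_snd.sub (hpm.comp measurable_fst))
  have hf0 : ∀ x y, 0 < f x y := fun x y => gaussDensity_pos h1p _
  have hq0 : ∀ x y, 0 < q x y := fun x y => gaussDensity_pos hSp _
  have hfD : ∀ x y, f x y ≤ _ := fun x y => gaussDensity_le h1p _
  have hqD : ∀ x y, q x y ≤ _ := fun x y => gaussDensity_le hSp _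
  have hf1 : ∀ x, ∫⁻ y, ENNReal.ofReal (f x y) = 1 := fun x =>
    (lintegral_sub_right_eq_self (fun y => ENNReal.ofReal (gaussDensity 1 y)) _).trans
      (lintegral_gaussDensity h1p)
  have hq1 : ∀ x, ∫⁻ y, ENNReal.ofReal (q x y) = 1 := fun x =>
    (lintegral_sub_right_eq_self (fun y => ENNReal.ofReal (gaussDensity S y)) _).trans
      (lintegral_gaussDensity hSp)
  -- The choice `R = A`: the true density is dominated by a multiple of its own mixture.
  have hfC : ∀ᵐ x ∂μ, ∀ y, f x y ≤
      (∏ e : A, if e.1 ∈ A then ((s.constellation e.1).card : ℝ) ^ Nt else 1) *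
        ∫ x', f x' y ∂μ := by
    filter_upwards [s.ae_le_card_mul_integral hu A A] with x hx y
    refine hx (fun x => f x y) (fun x => (hf0 x y).le) (integrable_section hf hf0 hfD y) ?_
    intro x x' h
    rw [funext fun e => h e e.2]
  have hqM : ∀ᵐ x ∂μ, ∀ y, q x y ≤ M * ∫ x', q x' y ∂μ := by
    filter_upwards [s.ae_le_card_mul_integral hu A R] with x hx y
    refine hx (fun x => q x y) (fun x => (hq0 x y).le) (integrable_section hq hq0 hqD y) ?_
    intro x x' h
    have : s.partialMean A R x = s.partialMean A R x' := by
      ext1 e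
      unfold System.partialMean
      split_ifs with he
      · exact h e he
      · rfl
    simp only [q, this]
  let Φ : ((e : A) → Fin Nt → ℂ) × (Fin Nr → ℂ) → ((e : A) → Fin Nt → ℂ) × (Fin Nr → ℂ) :=
    fun ω => (ω.1, s.signal n A ω.1 + ω.2)
  have hΦ : Measurable Φ :=
    measurable_fst.prodMk ((hsig.comp measurable_fst).add measurable_snd)
  have hP : ρ.map Φ = (μ.prod volume).withDensity fun z => ENNReal.ofReal (f z.1 z.2) := by
    have hfin : IsProbabilityMeasure ((volume : Measure (Fin Nr → ℂ)).withDensity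
        fun y => ENNReal.ofReal (gaussDensity 1 y)) := by
      rw [← noiseLaw_eq_withDensity]; infer_instance
    rw [hρ, noiseLaw_eq_withDensity]
    exact map_shear_prod_withDensity μ hsig
      (continuous_gaussDensity 1).measurable.ennreal_ofReal
  set a := fromCols (s.mixing n A R) (1 : Matrix (Fin Nr) (Fin Nr) ℂ) with ha
  have hlog : ∀ ω, Real.log (f (Φ ω).1 (Φ ω).2 / q (Φ ω).1 (Φ ω).2) =
      Real.log S.det.re + hermForm S⁻¹ (a *ᵥ fun k => s.centred A k ω) - ∑ i, ‖ω.2 i‖ ^ 2 := by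
    intro ω
    rw [Real.log_div (hf0 _ _).ne' (hq0 _ _).ne']
    simp only [f, q, Φ, log_gaussDensity h1p, log_gaussDensity hSp,
      s.signal_sub_signal_partialMean n A R, add_sub_cancel_left, inv_one, hermForm_one, det_one,
      Complex.one_re, Real.log_one]
    ring
  have hmem := s.memLp_centred hu A
  have hint₁ := integrable_hermForm S⁻¹ a hmem
  have hcoord : ∀ i : Fin Nr, MeasurePreserving (fun ω : ((e : A) → Fin Nt → ℂ) × (Fin Nr → ℂ) =>
      ω.2 i) ρ complexGaussian := fun i => s.measurePreserving_coord hu A (Sum.inr i)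
  have hsq : ∀ i : Fin Nr, Integrable (fun ω : ((e : A) → Fin Nt → ℂ) × (Fin Nr → ℂ) =>
      ‖ω.2 i‖ ^ 2) ρ := fun i =>
    (memLp_complexGaussian.comp_measurePreserving (hcoord i)).integrable_norm_pow
      (p := 2) (by norm_num)
  have hint₂ : Integrable (fun ω : ((e : A) → Fin Nt → ℂ) × (Fin Nr → ℂ) =>
      ∑ i, ‖ω.2 i‖ ^ 2) ρ := integrable_finsetSum _ fun i _ => hsq i
  have hint₃ : Integrable (fun ω => Real.log S.det.re +
      hermForm S⁻¹ (a *ᵥ fun k => s.centred A k ω)) ρ := (integrable_const _).add hint₁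
  have hlm : Measurable fun z : ((e : A) → Fin Nt → ℂ) × (Fin Nr → ℂ) =>
      Real.log (f z.1 z.2 / q z.1 z.2) := Real.measurable_log.comp (hf.div hq)
  have hint : Integrable (fun z => Real.log (f z.1 z.2 / q z.1 z.2)) (ρ.map Φ) := by
    rw [integrable_map_measure hlm.aestronglyMeasurable hΦ.aemeasurable]
    exact (hint₃.sub hint₂).congr (Filter.Eventually.of_forall fun ω => (hlog ω).symm)
  have hval : ∫ z, Real.log (f z.1 z.2 / q z.1 z.2) ∂(ρ.map Φ) ≤ Real.log S.det.re := by
    rw [integral_map hΦ.aemeasurable hlm.aestronglyMeasurable]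
    simp only [hlog]
    -- Since `a * aᴴ = S`, the trace is that of the identity; it offsets the mean noise energy `Nr`.
    have htr : (S⁻¹ * (a * aᴴ)).trace.re = Nr := by
      rw [ha, s.fromCols_mul_conjTranspose hb, ← hS,
        nonsing_inv_mul _ hSp.det_pos.ne'.isUnit, trace_one]
      simp
    have hle := integral_hermForm_le hSp.inv.posSemidef a hmem
      (fun k l hkl => s.integral_centred_orthogonal hu A hkl) (s.integral_norm_centred_sq_le hu A)
    have hnoise : ∀ i : Fin Nr, ∫ ω : ((e : A) → Fin Nt → ℂ) × (Fin Nr → ℂ),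
        ‖ω.2 i‖ ^ 2 ∂ρ = 1 := fun i =>
      (integral_comp_of_measurePreserving (hcoord i) (f := fun z => ‖z‖ ^ 2)
        (Measurable.aestronglyMeasurable (by fun_prop))).trans integral_norm_sq_complexGaussian
    rw [integral_sub hint₃ hint₂, integral_add (integrable_const _) hint₁,
      integral_finsetSum _ fun i _ => hsq i]
    simp only [hnoise, integral_const, probReal_univ, one_smul, Finset.sum_const,
      Finset.card_univ, Fintype.card_fin, nsmul_eq_mul, mul_one]
    rw [htr] at hle
    linarith
  have hkl := klDiv_withDensity_le hf hq hf0 hq0 hfD hqD hf1 hq1 hfC hM0 hqM hP hint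
  -- The shear `Φ` carries input and noise to the joint law of input and output, whose first
  -- marginal is `μ`.
  have hinfo : s.info n A = InformationTheory.klDiv (ρ.map Φ)
      (μ.prod ((ρ.map Φ).map Prod.snd)) := by
    have h1 : ρ.map (fun ω => ω.1) = μ := measurePreserving_fst.map_eq
    have h2 : (ρ.map Φ).map Prod.snd = ρ.map fun ω => s.output n A ω.1 ω.2 :=
      Measure.map_map measurable_snd hΦ
    rw [h2]
    conv_rhs => rw [← h1]
    rfl
  rw [hinfo]
  refine hkl.trans (ENNReal.ofReal_le_ofReal ?_)
  have hdet : s.logDet n (A \ R) = Real.log S.det.re := rfl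
  rw [hdet, ← hlogM]
  linarith

end GaussianChannel

end Uplink

theorem proposition1 {K N Nr Nt : ℕ} (s : Uplink.System K N Nr Nt)
    (hbudget : ∀ k, 0 ≤ s.budget k) (hunit : s.UnitEnergy) :
    (∀ (n : Fin N) (A : Finset s.Element), s.info n A ≤ ENNReal.ofReal (s.gRB n A)) ∧
      Uplink.IsRankFunction s.g := by
  classical
  refine ⟨fun n A => ?_, s.g_isRankFunction hbudget⟩
  obtain ⟨R, hR, h⟩ := Finset.exists_mem_eq_inf' (⟨∅, Finset.empty_mem_powerset A⟩ :
    A.powerset.Nonempty) (fun R => s.logDet n (A \ R) +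
      ∑ e ∈ R, (Nt : ℝ) * Real.log ((s.constellation e).card : ℝ))
  have hg : s.gRB n A = s.logDet n (A \ R) +
      ∑ e ∈ R, (Nt : ℝ) * Real.log ((s.constellation e).card : ℝ) := by
    rw [← h, Uplink.System.gRB]
  rw [hg]
  exact s.info_le hbudget hunit n A R (Finset.mem_powerset.1 hR)
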